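/- Notation: for $x\in\mathbb R^n_{>0}$ and $y\in\mathbb R^n$ let $x^y=\prod_i x_i^{y_i}$; for $B=(b^1,\dots,b^m)\in\mathbb R^{n\times m}$ let $x^B\in\mathbb R^m$ be the vector with components $x^{b^j}$. Write $\circ$ for the componentwise product, $1_m$ for the all-ones vector in $\mathbb R^m$ (used as a row in $\binom{B}{1_{m}}$), and $\operatorname{sgnvar}$ for the number of sign changes in a finite real sequence, zeros being discarded. A subspace of $\mathbb R^m$ is a \emph{direct product} if, for some partition of $\{1,\dots,m\}$ into two nonempty classes $S,S'$, it is the product of a subspace of $\mathbb R^{S}$ and a subspace of $\mathbb R^{S'}$. The \emph{multiplicity} of a positive solution $x^*$ of $A\,x^B=0$ with $A\in\mathbb R^{n\times m}$ is $\dim_{\mathbb R}\mathbb R[[u_1,\dots,u_n]]/(F_1,\dots,F_n)$, where $F_i$ is the Taylor series at $x^*$ (in $u=x-x^*$) of the $i$-th component of $A\,x^B$. Theorem. Let $A,B\in\mathbb R^{n\times(n+2)}$ and consider the system $A\,x^B=0$ of $n$ generalized polynomial equations (after Gaussian elimination: overlapping trinomials) in $n$ positive variables involving $n+2$ monomials.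 Assume that $A$ has full row rank, that $\ker A$ contains a vector with all components positive, and that (i) $\ker A$ is not a direct product, and (ii) $\ker\binom{B}{1_{n+2}}$ has dimension one. Then, after a suitable reordering of the columns of $A$ (and correspondingly of $B$), $$\ker A=c\circ\operatorname{im}\begin{pmatrix}1_{n+2}&q\end{pmatrix}\quad\text{with } c\in\mathbb R^{n+2}_{>0},\ q\in\mathbb R^{n+2},\ 1=q_1\ge q_2\ge\dots\ge q_{n+2}=-1 .$$ For every such reordering and all such $c,q$, let $b\in\mathbb R^{n+2}$ span $\ker\binom{B}{1_{n+2}}$ (for the reordered $B$), let $s_i=\sum_{j=1}^i b_j$ for $i=1,\dots,n+1$, and let $n_{A,B}$ be the number of positive solutions $x\in\mathbb R^n_{>0}$ of $A\,x^B=0$, counted with multiplicity. Suppose that the set of positive solutions is finite. If the components of $q$ are all different, then $$n_{A,B}\le 1+\operatorname{sgnvar}(s_1,\dots,s_{n+1})\le n+1 .$$ In general, let $I_1,\dots,I_k\subset\{1,\dots,n+2\}$ be the classes of indices with equal components of $q$ (ordered increasingly, so that $k$ is the number of distinct components of $q$), let $\tilde b_i=\sum_{j\in I_i}b_j$ for $i=1,\dots,k$,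 and $\tilde s_i=\sum_{j=1}^i\tilde b_j$ for $i=1,\dots,k-1$. Then $$n_{A,B}\le 1+\operatorname{sgnvar}(\tilde s_1,\dots,\tilde s_{k-1})\le k-1 .$$ -/

import Mathlib

/-- The generalized monomial `x ^ y = ∏ i, x i ^ y i` with real exponents (used for `x > 0`). -/
noncomputable def genMonomial {n : ℕ} (x y : Fin n → ℝ) : ℝ :=
  ∏ i, x i ^ y i

/-- The map `x ↦ A x ^ B`, whose `i`-th component is `∑ j, A i j * x ^ (j-th column of B)`. -/
noncomputable def genPolySystem {p n m : ℕ} (A : Matrix (Fin p) (Fin m) ℝ)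
    (B : Matrix (Fin n) (Fin m) ℝ) (x : Fin n → ℝ) : Fin p → ℝ :=
  A.mulVec fun j => genMonomial x fun l => B l j

/-- The set of positive solutions of `A x ^ B = 0`. -/
def positiveSolutions {p n m : ℕ} (A : Matrix (Fin p) (Fin m) ℝ)
    (B : Matrix (Fin n) (Fin m) ℝ) : Set (Fin n → ℝ) :=
  {x | (∀ i, 0 < x i) ∧ genPolySystem A B x = 0}

/-- The partial derivative in the `i`-th coordinate direction. -/
noncomputable def partialDeriv {n : ℕ} (i : Fin n) (f : (Fin n → ℝ) → ℝ) : (Fin n → ℝ) → ℝ :=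
  fun x => lineDeriv ℝ f x (Pi.single i 1)

/-- The mixed partial derivative `∂₀ ^ k₀ ⋯ ∂ₙ₋₁ ^ kₙ₋₁ f`. -/
noncomputable def mixedPartial {n : ℕ} (k : Fin n →₀ ℕ) (f : (Fin n → ℝ) → ℝ) :
    (Fin n → ℝ) → ℝ :=
  (List.finRange n).foldr (fun i g => (partialDeriv i)^[k i] g) f

/-- The Taylor series of `f` at `a`, as a formal power series in `x - a`. -/
noncomputable def taylorMvSeries {n : ℕ} (f : (Fin n → ℝ) → ℝ) (a : Fin n → ℝ) :
    MvPowerSeries (Fin n) ℝ :=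
  fun k => mixedPartial k f a / ∏ i, ((k i).factorial : ℝ)

/-- The multiplicity of `a` as a zero of `F = (F₁, …, F_p)`: the dimension over `ℝ` of the local
algebra `ℝ⟦x - a⟧ ⧸ (F₁, …, F_p)`, where every `F i` is replaced by its Taylor series at `a`. -/
noncomputable def zeroMultiplicity {p n : ℕ} (F : (Fin n → ℝ) → (Fin p → ℝ)) (a : Fin n → ℝ) :
    ℕ∞ :=
  Cardinal.toENat (Module.rank ℝ (MvPowerSeries (Fin n) ℝ ⧸
    Ideal.span (Set.range fun i : Fin p => taylorMvSeries (fun x => F x i) a)))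

/-- The number of positive solutions of `A x ^ B = 0`, counted with multiplicity. -/
noncomputable def numPositiveSolutions {p n m : ℕ} (A : Matrix (Fin p) (Fin m) ℝ)
    (B : Matrix (Fin n) (Fin m) ℝ) : ℕ∞ :=
  ∑' x : positiveSolutions A B, zeroMultiplicity (genPolySystem A B) (x : Fin n → ℝ)

/-- A subspace `V` of `ℝ^m` is a direct product if, for some partition of the indices into two
nonempty classes `S` and `Sᶜ`, it is the product of a subspace of `ℝ^S` and one of `ℝ^Sᶜ`. -/
def IsDirectProduct {m : ℕ} (V : Submodule ℝ (Fin m → ℝ)) : Prop :=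
  ∃ S : Set (Fin m), S.Nonempty ∧ Sᶜ.Nonempty ∧
    ∃ (V₁ : Submodule ℝ (S → ℝ)) (V₂ : Submodule ℝ (↥Sᶜ → ℝ)),
      ∀ v : Fin m → ℝ, v ∈ V ↔ S.domRestrict v ∈ V₁ ∧ Sᶜ.domRestrict v ∈ V₂

/-- The matrix `B` with an additional row of ones. -/
def withOnesRow {n m : ℕ} (B : Matrix (Fin n) (Fin m) ℝ) : Matrix (Fin n ⊕ Unit) (Fin m) ℝ :=
  Matrix.fromRows B (Matrix.of fun _ _ => 1)

/-- `ker A = c ∘ im (1 q)` with `c > 0` and `1 = q₁ ≥ ⋯ ≥ qₙ₊₂ = -1`. -/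
structure IsKernelForm {n : ℕ} (A : Matrix (Fin n) (Fin (n + 2)) ℝ) (c q : Fin (n + 2) → ℝ) :
    Prop where
  pos : ∀ j, 0 < c j
  anti : Antitone q
  first : q 0 = 1
  last : q (Fin.last (n + 1)) = -1
  ker_eq : ∀ y : Fin (n + 2) → ℝ,
    y ∈ LinearMap.ker A.mulVecLin ↔ ∃ α β : ℝ, ∀ j, y j = c j * (α + β * q j)

/-- The number of sign changes in a finite sequence of reals; zeros are discarded. -/
noncomputable def signVar {m : ℕ} (s : Fin m → ℝ) : ℕ :=
  ((((List.ofFn s).map SignType.sign).filter (· ≠ 0)).destutter (· ≠ ·)).length - 1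

/-- The proper partial sums `s_i = b_1 + ⋯ + b_i`, `i = 1, …, m - 1`, of `b ∈ ℝ^m`. -/
noncomputable def partialSums {m : ℕ} (b : Fin m → ℝ) : Fin (m - 1) → ℝ :=
  fun i => ∑ j : Fin m with j.val ≤ i.val, b j

/-- The vector of the sums of `b` over the classes `I_i = {j | r j = i}`. -/
noncomputable def mergeClasses {m k : ℕ} (r : Fin m → Fin k) (b : Fin m → ℝ) : Fin k → ℝ :=
  fun i => ∑ j : Fin m with r j = i, b j

/-!
The kernel of `A` is two-dimensional and contains a positive vector `c`, so it has the form
`c ∘ im (1 q)`, where `q` is obtained by sorting and normalizing the quotients of a second kernel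
vector by `c` (`exists_isKernelForm`). A positive solution `x` therefore has monomial vector
`x ^ B = c ∘ (α + β q)` with `|β| < α`. Put `τ = β / α ∈ (-1, 1)`. Since the rows of `B` and the row
of ones are linearly independent, `x` is determined by `τ`, and orthogonality of `log (x ^ B)` to
`b` says that `τ` is a zero of `g τ = ∑ b_j log (c_j (1 + τ q_j))`.

Multiplicities (`zeroMultiplicity_le`): Taylor expansion at a solution `a` is a ring homomorphism on
functions analytic at `a`. Subtracting a combination of the equations from the monomials puts the
monomial vector into `ker A` identically, which makes `α`, `β`, `τ` analytic functions of `x`.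
Taking logarithms, every `log x_l` is a function of `τ` modulo the ideal `I` of the equations, and
`g ∘ τ ∈ I`. So with `ν` the Taylor series of `τ - τ a` the maximal ideal is generated by `ν` modulo
`I`, and `ν ^ m ∈ I` if `g` vanishes to order `m` at `τ a`. The local algebra is thus spanned by
`1, ν, …, ν ^ (m - 1)`, and its dimension is at most `m`.

Zeros of `g` (`sum_analyticOrderAt_sum_log_le`): as `∑ b_j = 0`, the derivative of `g` is the
integral over `[-1, 1]` of `w q * (1 + τ q)⁻¹ ^ 2`, where `w q = ∑ b_j` over all `j` with `q_j > q`.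
This step function takes the partial sums of the merged vector as its values. A rule of signs for
the kernels `(1 + τ q)⁻¹ ^ N` (`sum_analyticOrderAt_integral_le`), proved by Rolle's theorem and
induction on the number of sign changes, bounds the zeros of the derivative, and Rolle's theorem
once more bounds those of `g`. If all merged partial sums vanish, then `g` is constant, and
finiteness of the solution set excludes that there are any solutions.
-/

open Filter Topology

/-! ### Taylor series of analytic functions -/

section Taylor

variable {n : ℕ} {a : Fin n → ℝ} {f g : (Fin n → ℝ) → ℝ}

theorem partialDeriv_congr (i : Fin n) (h : f =ᶠ[𝓝 a] g) :
    partialDeriv i f =ᶠ[𝓝 a] partialDeriv i g :=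
  h.eventuallyEq_nhds.mono fun _ hx => hx.lineDeriv_eq

theorem partialDeriv_eventuallyEq_fderiv (i : Fin n) (hf : AnalyticAt ℝ f a) :
    partialDeriv i f =ᶠ[𝓝 a] fun x => fderiv ℝ f x (Pi.single i 1) :=
  hf.eventually_analyticAt.mono fun _ hx => hx.differentiableAt.lineDeriv_eq_fderiv

theorem AnalyticAt.partialDeriv (i : Fin n) (hf : AnalyticAt ℝ f a) :
    AnalyticAt ℝ (partialDeriv i f) a :=
  (((ContinuousLinearMap.apply ℝ ℝ (Pi.single i (1 : ℝ) : Fin n → ℝ)).analyticAt _).comp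
    hf.fderiv).congr (partialDeriv_eventuallyEq_fderiv i hf).symm

theorem partialDeriv_comm (i j : Fin n) (hf : AnalyticAt ℝ f a) :
    partialDeriv i (partialDeriv j f) =ᶠ[𝓝 a] partialDeriv j (partialDeriv i f) := by
  have key : ∀ i j : Fin n, partialDeriv i (partialDeriv j f) =ᶠ[𝓝 a]
      fun x => fderiv ℝ (fderiv ℝ f) x (Pi.single i 1) (Pi.single j 1) := by
    intro i j
    refine (partialDeriv_congr i (partialDeriv_eventuallyEq_fderiv j hf)).trans ?_
    filter_upwards [hf.fderiv.eventually_analyticAt] with x hx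
    have h1 : HasFDerivAt (fun x => fderiv ℝ f x (Pi.single j 1))
        ((fderiv ℝ (fderiv ℝ f) x).flip (Pi.single j 1)) x := by
      simpa using hx.differentiableAt.hasFDerivAt.clm_apply
        (hasFDerivAt_const (Pi.single j (1 : ℝ) : Fin n → ℝ) x)
    exact (h1.hasLineDerivAt _).lineDeriv
  filter_upwards [key i j, key j i, hf.eventually_analyticAt] with x h1 h2 hx
  rw [h1, h2]
  exact (hx.contDiffAt (n := ⊤)).isSymmSndFDerivAt_of_omega _ _

theorem iterate_partialDeriv_congr (i : Fin n) (k : ℕ) (h : f =ᶠ[𝓝 a] g) :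
    (partialDeriv i)^[k] f =ᶠ[𝓝 a] (partialDeriv i)^[k] g := by
  induction k with
  | zero => exact h
  | succ k ih => simpa only [Function.iterate_succ_apply'] using partialDeriv_congr i ih

theorem AnalyticAt.iterate_partialDeriv (i : Fin n) (k : ℕ) (hf : AnalyticAt ℝ f a) :
    AnalyticAt ℝ ((_root_.partialDeriv i)^[k] f) a := by
  induction k with
  | zero => exact hf
  | succ k ih => simpa only [Function.iterate_succ_apply'] using ih.partialDeriv i

theorem iterate_partialDeriv_comm (i j : Fin n) (k : ℕ) (hf : AnalyticAt ℝ f a) :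
    (partialDeriv i)^[k] (partialDeriv j f) =ᶠ[𝓝 a] partialDeriv j ((partialDeriv i)^[k] f) := by
  induction k with
  | zero => rfl
  | succ k ih =>
    simp only [Function.iterate_succ_apply']
    exact (partialDeriv_congr i ih).trans (partialDeriv_comm i j (hf.iterate_partialDeriv i k))

theorem foldr_partialDeriv_congr (k : Fin n →₀ ℕ) (h : f =ᶠ[𝓝 a] g) (L : List (Fin n)) :
    L.foldr (fun i g => (partialDeriv i)^[k i] g) f =ᶠ[𝓝 a]
      L.foldr (fun i g => (partialDeriv i)^[k i] g) g := by
  induction L with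
  | nil => exact h
  | cons i L ih => exact iterate_partialDeriv_congr i _ ih

theorem AnalyticAt.foldr_partialDeriv (k : Fin n →₀ ℕ) (hf : AnalyticAt ℝ f a)
    (L : List (Fin n)) :
    AnalyticAt ℝ (L.foldr (fun i g => (_root_.partialDeriv i)^[k i] g) f) a := by
  induction L with
  | nil => exact hf
  | cons i L ih => exact ih.iterate_partialDeriv i _

theorem foldr_partialDeriv_comm (k : Fin n →₀ ℕ) (j : Fin n) (hf : AnalyticAt ℝ f a)
    (L : List (Fin n)) :
    L.foldr (fun i g => (partialDeriv i)^[k i] g) (partialDeriv j f) =ᶠ[𝓝 a]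
      partialDeriv j (L.foldr (fun i g => (partialDeriv i)^[k i] g) f) := by
  induction L with
  | nil => rfl
  | cons i L ih =>
    exact (iterate_partialDeriv_congr i _ ih).trans
      (iterate_partialDeriv_comm i j _ (hf.foldr_partialDeriv k L))

theorem foldr_partialDeriv_add_single (k : Fin n →₀ ℕ) (j : Fin n) (hf : AnalyticAt ℝ f a)
    (L : List (Fin n)) (hL : L.Nodup) :
    L.foldr (fun i g => (partialDeriv i)^[(k + Finsupp.single j 1 : Fin n →₀ ℕ) i] g) f =ᶠ[𝓝 a]
      if j ∈ L then L.foldr (fun i g => (partialDeriv i)^[k i] g) (partialDeriv j f)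
      else L.foldr (fun i g => (partialDeriv i)^[k i] g) f := by
  induction L with
  | nil => simp
  | cons i L ih =>
    rw [List.nodup_cons] at hL
    have ih := iterate_partialDeriv_congr i ((k + Finsupp.single j 1 : Fin n →₀ ℕ) i) (ih hL.2)
    refine ih.trans ?_
    by_cases hij : i = j
    · subst hij
      simp only [hL.1, if_false, List.mem_cons, true_or, if_true, List.foldr_cons,
        Finsupp.add_apply, Finsupp.single_eq_same, Function.iterate_succ_apply]
      exact iterate_partialDeriv_congr i _ (foldr_partialDeriv_comm k i hf L).symm
    · have h0 : (k + Finsupp.single j 1 : Fin n →₀ ℕ) i = k i := by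
        simp [Ne.symm hij]
      rw [h0]
      by_cases hj : j ∈ L <;> simp [hj, Ne.symm hij]

theorem mixedPartial_add_single (k : Fin n →₀ ℕ) (j : Fin n) (hf : AnalyticAt ℝ f a) :
    mixedPartial (k + Finsupp.single j 1) f a = mixedPartial k (partialDeriv j f) a := by
  have h := (foldr_partialDeriv_add_single k j hf _ (List.nodup_finRange n)).eq_of_nhds
  simp only [List.mem_finRange, if_true] at h
  exact h

theorem taylorMvSeries_congr (h : f =ᶠ[𝓝 a] g) : taylorMvSeries f a = taylorMvSeries g a := by
  funext k
  exact congrArg (· / _) (foldr_partialDeriv_congr k h _).eq_of_nhds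

theorem constantCoeff_taylorMvSeries :
    MvPowerSeries.constantCoeff (taylorMvSeries f a) = f a := by
  change mixedPartial 0 f a / _ = f a
  simp [mixedPartial]

theorem pderiv_taylorMvSeries (j : Fin n) (hf : AnalyticAt ℝ f a) :
    MvPowerSeries.pderiv ℝ j (taylorMvSeries f a) = taylorMvSeries (partialDeriv j f) a := by
  ext k
  rw [MvPowerSeries.coeff_pderiv]
  change mixedPartial (k + Finsupp.single j 1) f a / _ * _ = mixedPartial k (partialDeriv j f) a / _
  rw [mixedPartial_add_single k j hf]
  have h : ∏ i, (((k + Finsupp.single j 1 : Fin n →₀ ℕ) i).factorial : ℝ) =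
      (∏ i, ((k i).factorial : ℝ)) * (k j + 1) := by
    rw [← Finset.mul_prod_erase _ _ (Finset.mem_univ j),
      ← Finset.mul_prod_erase _ (fun i => ((k i).factorial : ℝ)) (Finset.mem_univ j)]
    have : ∏ i ∈ Finset.univ.erase j, (((k + Finsupp.single j 1 : Fin n →₀ ℕ) i).factorial : ℝ) =
        ∏ i ∈ Finset.univ.erase j, ((k i).factorial : ℝ) :=
      Finset.prod_congr rfl fun i hi => by
        simp [(Finset.ne_of_mem_erase hi).symm]
    rw [this]
    simp [Nat.factorial_succ]
    ring
  rw [h]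
  have h1 : (k j + 1 : ℝ) ≠ 0 := by positivity
  have h2 : ∏ i, ((k i).factorial : ℝ) ≠ 0 := by positivity
  field_simp

/-- Two formal power series over `ℝ` agree up to degree `d` if their constant coefficients agree
and their partial derivatives agree below degree `d`. By induction on `d` this reduces identities
between Taylor series to identities between derivatives. -/
theorem MvPowerSeries.coeff_eq_of_pderiv {P Q : MvPowerSeries (Fin n) ℝ} {d : ℕ}
    (h0 : constantCoeff P = constantCoeff Q)
    (h : ∀ j, ∀ k : Fin n →₀ ℕ, k.degree < d → coeff k (pderiv ℝ j P) = coeff k (pderiv ℝ j Q))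
    (k : Fin n →₀ ℕ) (hk : k.degree ≤ d) : coeff k P = coeff k Q := by
  by_cases hk0 : k = 0
  · subst hk0; simpa using h0
  · obtain ⟨j, hj⟩ : ∃ j, k j ≠ 0 := by
      by_contra! hcon; exact hk0 (Finsupp.ext hcon)
    have hkj : k - Finsupp.single j 1 + Finsupp.single j 1 = k :=
      tsub_add_cancel_of_le (by simpa [Nat.one_le_iff_ne_zero] using hj)
    have hdeg : (k - Finsupp.single j 1).degree < d := by
      have := congrArg Finsupp.degree hkj
      rw [map_add, Finsupp.degree_single] at this
      omega
    have := h j _ hdeg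
    rw [coeff_pderiv, coeff_pderiv, hkj] at this
    exact mul_right_cancel₀ (by positivity) this

theorem taylorMvSeries_const (c : ℝ) :
    taylorMvSeries (fun _ => c) a = MvPowerSeries.C c := by
  have h0 : ∀ i : Fin n, ∀ c : ℝ, partialDeriv i (fun _ : Fin n → ℝ => c) = fun _ => 0 := by
    intro i c; funext x
    exact ((hasFDerivAt_const c x).hasLineDerivAt _).lineDeriv
  have key : ∀ d : ℕ, ∀ c : ℝ, ∀ k : Fin n →₀ ℕ, k.degree ≤ d →
      MvPowerSeries.coeff k (taylorMvSeries (fun _ => c) a) =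
        MvPowerSeries.coeff k (MvPowerSeries.C c) := by
    intro d
    induction d with
    | zero =>
      intro c
      exact MvPowerSeries.coeff_eq_of_pderiv (by simp [constantCoeff_taylorMvSeries])
        (by simp)
    | succ d ih =>
      intro c
      refine MvPowerSeries.coeff_eq_of_pderiv (by simp [constantCoeff_taylorMvSeries]) ?_
      intro j k hk
      rw [pderiv_taylorMvSeries j analyticAt_const, h0, ih 0 k (by omega)]
      simp
  ext k
  exact key _ c k le_rfl

theorem taylorMvSeries_coord (l : Fin n) :
    taylorMvSeries (fun x => x l) a = MvPowerSeries.C (a l) + MvPowerSeries.X l := by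
  have han : AnalyticAt ℝ (fun x : Fin n → ℝ => x l) a :=
    (ContinuousLinearMap.proj (R := ℝ) (φ := fun _ : Fin n => ℝ) l).analyticAt a
  ext k
  refine MvPowerSeries.coeff_eq_of_pderiv (d := k.degree) ?_ ?_ k le_rfl
  · simp [constantCoeff_taylorMvSeries]
  · intro j k _
    rw [pderiv_taylorMvSeries j han]
    have : partialDeriv j (fun x : Fin n → ℝ => x l) = fun _ => if l = j then 1 else 0 := by
      funext x
      have h := ((ContinuousLinearMap.proj (R := ℝ) (φ := fun _ : Fin n => ℝ) l).hasFDerivAt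
        (x := x)).hasLineDerivAt (Pi.single j 1)
      refine h.lineDeriv.trans ?_
      simp [Pi.single_apply]
    rw [this, taylorMvSeries_const]
    by_cases hlj : l = j
    · subst hlj; simp
    · simp [hlj, MvPowerSeries.pderiv_X_of_ne]

theorem partialDeriv_add (j : Fin n) (hf : AnalyticAt ℝ f a) (hg : AnalyticAt ℝ g a) :
    partialDeriv j (fun x => f x + g x) =ᶠ[𝓝 a]
      fun x => partialDeriv j f x + partialDeriv j g x := by
  filter_upwards [hf.eventually_analyticAt, hg.eventually_analyticAt] with x hfx hgx
  have h := (hfx.differentiableAt.hasFDerivAt.add hgx.differentiableAt.hasFDerivAt).hasLineDerivAt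
    (Pi.single j 1)
  refine h.lineDeriv.trans ?_
  simp [partialDeriv, hfx.differentiableAt.lineDeriv_eq_fderiv,
    hgx.differentiableAt.lineDeriv_eq_fderiv]

theorem partialDeriv_mul (j : Fin n) (hf : AnalyticAt ℝ f a) (hg : AnalyticAt ℝ g a) :
    partialDeriv j (fun x => f x * g x) =ᶠ[𝓝 a]
      fun x => f x * partialDeriv j g x + partialDeriv j f x * g x := by
  filter_upwards [hf.eventually_analyticAt, hg.eventually_analyticAt] with x hfx hgx
  have h := (hfx.differentiableAt.hasFDerivAt.mul hgx.differentiableAt.hasFDerivAt).hasLineDerivAt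
    (Pi.single j 1)
  refine h.lineDeriv.trans ?_
  simp [partialDeriv, hfx.differentiableAt.lineDeriv_eq_fderiv,
    hgx.differentiableAt.lineDeriv_eq_fderiv]
  ring

theorem taylorMvSeries_add (hf : AnalyticAt ℝ f a) (hg : AnalyticAt ℝ g a) :
    taylorMvSeries (fun x => f x + g x) a = taylorMvSeries f a + taylorMvSeries g a := by
  have key : ∀ d : ℕ, ∀ f g : (Fin n → ℝ) → ℝ, AnalyticAt ℝ f a → AnalyticAt ℝ g a →
      ∀ k : Fin n →₀ ℕ, k.degree ≤ d →
      MvPowerSeries.coeff k (taylorMvSeries (fun x => f x + g x) a) =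
        MvPowerSeries.coeff k (taylorMvSeries f a + taylorMvSeries g a) := by
    intro d
    induction d with
    | zero =>
      intro f g hf hg
      exact MvPowerSeries.coeff_eq_of_pderiv (by simp [constantCoeff_taylorMvSeries]) (by simp)
    | succ d ih =>
      intro f g hf hg
      refine MvPowerSeries.coeff_eq_of_pderiv (by simp [constantCoeff_taylorMvSeries]) ?_
      intro j k hk
      rw [pderiv_taylorMvSeries j (hf.fun_add hg), taylorMvSeries_congr (partialDeriv_add j hf hg),
        ih _ _ (hf.partialDeriv j) (hg.partialDeriv j) k (by omega),
        map_add (MvPowerSeries.pderiv ℝ j),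
        pderiv_taylorMvSeries j hf, pderiv_taylorMvSeries j hg]
  ext k
  exact key _ f g hf hg k le_rfl

theorem taylorMvSeries_mul (hf : AnalyticAt ℝ f a) (hg : AnalyticAt ℝ g a) :
    taylorMvSeries (fun x => f x * g x) a = taylorMvSeries f a * taylorMvSeries g a := by
  have key : ∀ d : ℕ, ∀ f g : (Fin n → ℝ) → ℝ, AnalyticAt ℝ f a → AnalyticAt ℝ g a →
      ∀ k : Fin n →₀ ℕ, k.degree ≤ d →
      MvPowerSeries.coeff k (taylorMvSeries (fun x => f x * g x) a) =
        MvPowerSeries.coeff k (taylorMvSeries f a * taylorMvSeries g a) := by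
    intro d
    induction d with
    | zero =>
      intro f g hf hg
      exact MvPowerSeries.coeff_eq_of_pderiv (by simp [constantCoeff_taylorMvSeries]) (by simp)
    | succ d ih =>
      intro f g hf hg
      refine MvPowerSeries.coeff_eq_of_pderiv (by simp [constantCoeff_taylorMvSeries]) ?_
      intro j k hk
      rw [pderiv_taylorMvSeries j (hf.fun_mul hg), taylorMvSeries_congr (partialDeriv_mul j hf hg),
        taylorMvSeries_add (hf.fun_mul (hg.partialDeriv j)) ((hf.partialDeriv j).fun_mul hg), map_add,
        ih _ _ hf (hg.partialDeriv j) k (by omega), ih _ _ (hf.partialDeriv j) hg k (by omega),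
        Derivation.leibniz, pderiv_taylorMvSeries j hf, pderiv_taylorMvSeries j hg, map_add,
        smul_eq_mul, smul_eq_mul, mul_comm (taylorMvSeries g a)]
  ext k
  exact key _ f g hf hg k le_rfl

theorem taylorMvSeries_sub_const (hf : AnalyticAt ℝ f a) (c : ℝ) :
    taylorMvSeries (fun x => f x - c) a = taylorMvSeries f a - MvPowerSeries.C c := by
  simp only [sub_eq_add_neg]
  rw [taylorMvSeries_add hf analyticAt_const, taylorMvSeries_const, map_neg]

theorem taylorMvSeries_const_mul (c : ℝ) (hf : AnalyticAt ℝ f a) :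
    taylorMvSeries (fun x => c * f x) a = MvPowerSeries.C c * taylorMvSeries f a := by
  rw [taylorMvSeries_mul analyticAt_const hf, taylorMvSeries_const]

theorem taylorMvSeries_sum {ι : Type*} (s : Finset ι) {F : ι → (Fin n → ℝ) → ℝ}
    (hF : ∀ i ∈ s, AnalyticAt ℝ (F i) a) :
    taylorMvSeries (fun x => ∑ i ∈ s, F i x) a = ∑ i ∈ s, taylorMvSeries (F i) a := by
  classical
  induction s using Finset.induction_on with
  | empty => simp [taylorMvSeries_const]
  | insert i s hi ih =>
    simp only [Finset.sum_insert hi]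
    rw [taylorMvSeries_add (hF i (Finset.mem_insert_self i s))
      (Finset.analyticAt_fun_sum s fun j hj => hF j (Finset.mem_insert_of_mem hj)),
      ih fun j hj => hF j (Finset.mem_insert_of_mem hj)]

theorem taylorMvSeries_pow (hf : AnalyticAt ℝ f a) (m : ℕ) :
    taylorMvSeries (fun x => f x ^ m) a = taylorMvSeries f a ^ m := by
  induction m with
  | zero => simpa using taylorMvSeries_const (a := a) 1
  | succ m ih =>
    simp only [pow_succ]
    rw [taylorMvSeries_mul (hf.fun_pow m) hf, ih]

/-- If `φ` vanishes to order at least `m` at `f a`, then the Taylor series of `φ ∘ f` at `a` is a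
multiple of the `m`-th power of the Taylor series of `f - f a`. -/
theorem taylorMvSeries_comp_eq {φ ψ : ℝ → ℝ} {m : ℕ} (hf : AnalyticAt ℝ f a)
    (hψ : AnalyticAt ℝ ψ (f a)) (h : ∀ᶠ z in 𝓝 (f a), φ z = (z - f a) ^ m • ψ z) :
    taylorMvSeries (fun x => φ (f x)) a =
      taylorMvSeries (fun x => f x - f a) a ^ m * taylorMvSeries (fun x => ψ (f x)) a := by
  have h1 : (fun x => φ (f x)) =ᶠ[𝓝 a] fun x => (f x - f a) ^ m * ψ (f x) :=
    hf.continuousAt.eventually h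
  have hs : AnalyticAt ℝ (fun x => f x - f a) a := hf.sub analyticAt_const
  rw [taylorMvSeries_congr h1,
    taylorMvSeries_mul (hs.fun_pow m) (hψ.fun_comp hf), taylorMvSeries_pow hs]

/-- If `φ` vanishes at `f a`, then the Taylor series of `φ ∘ f` at `a` lies in every ideal that
contains the Taylor series of `f - f a`. -/
theorem taylorMvSeries_comp_mem {φ : ℝ → ℝ} {I : Ideal (MvPowerSeries (Fin n) ℝ)}
    (hf : AnalyticAt ℝ f a) (hφ : AnalyticAt ℝ φ (f a)) (h0 : φ (f a) = 0)
    (hI : taylorMvSeries (fun x => f x - f a) a ∈ I) :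
    taylorMvSeries (fun x => φ (f x)) a ∈ I := by
  have h1 : ((1 : ℕ) : ℕ∞) ≤ analyticOrderAt φ (f a) := by
    rw [Nat.cast_one, Order.one_le_iff_ne_zero]
    exact analyticOrderAt_ne_zero.2 ⟨hφ, h0⟩
  obtain ⟨ψ, hψ, h⟩ := (natCast_le_analyticOrderAt hφ).1 h1
  rw [taylorMvSeries_comp_eq hf hψ h, pow_one]
  exact I.mul_mem_right _ hI

end Taylor

/-! ### The length of the local algebra -/

section LocalAlgebra

variable {n : ℕ}

theorem MvPowerSeries.mem_of_constantCoeff_eq_zero {I : Ideal (MvPowerSeries (Fin n) ℝ)}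
    (hI : ∀ l, X l ∈ I) {P : MvPowerSeries (Fin n) ℝ} (hP : constantCoeff P = 0) : P ∈ I := by
  classical
  have key : ∀ s : Finset (Fin n), ∀ P : MvPowerSeries (Fin n) ℝ,
      (∀ k : Fin n →₀ ℕ, (∀ i ∈ s, k i = 0) → coeff k P = 0) → P ∈ I := by
    intro s
    induction s using Finset.induction_on with
    | empty =>
      intro P hP
      have : P = 0 := by ext k; simpa using hP k (by simp)
      rw [this]; exact I.zero_mem
    | insert i s hi ih =>
      intro P hP
      let P₁ : MvPowerSeries (Fin n) ℝ := fun k => if k i = 0 then 0 else coeff k P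
      let P₂ : MvPowerSeries (Fin n) ℝ := fun k => if k i = 0 then coeff k P else 0
      have h₁ : ∀ k, coeff k P₁ = if k i = 0 then 0 else coeff k P := fun k => rfl
      have h₂ : ∀ k, coeff k P₂ = if k i = 0 then coeff k P else 0 := fun k => rfl
      have hsum : P = P₁ + P₂ := by
        ext k
        rw [map_add, h₁, h₂]
        split_ifs <;> simp
      rw [hsum]
      refine I.add_mem ?_ (ih P₂ fun k hk => ?_)
      · exact I.mem_of_dvd (X_dvd_iff.2 fun k hk => by rw [h₁, if_pos hk]) (hI i)
      · rw [h₂]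
        split_ifs with h
        · refine hP k fun j hj => ?_
          rcases Finset.mem_insert.1 hj with rfl | hj
          exacts [h, hk j hj]
        · rfl
  refine key Finset.univ P fun k hk => ?_
  have : k = 0 := Finsupp.ext fun i => hk i (Finset.mem_univ i)
  subst this
  simpa using hP

/-- If the maximal ideal of the power series ring is generated by `ν` modulo `I`, and `ν ^ m ∈ I`,
then the quotient by `I` is spanned by `1, ν, …, ν ^ (m - 1)`. -/
theorem MvPowerSeries.toENat_rank_quotient_le {I : Ideal (MvPowerSeries (Fin n) ℝ)}
    {ν : MvPowerSeries (Fin n) ℝ} {m : ℕ} (hX : ∀ l, X l ∈ I ⊔ Ideal.span {ν})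
    (hν : ν ^ m ∈ I) :
    Cardinal.toENat (Module.rank ℝ (MvPowerSeries (Fin n) ℝ ⧸ I)) ≤ m := by
  classical
  set z : MvPowerSeries (Fin n) ℝ ⧸ I := Ideal.Quotient.mk I ν with hz
  have hzm : z ^ m = 0 := by
    rw [hz, ← map_pow]; exact Ideal.Quotient.eq_zero_iff_mem.2 hν
  have hdiv : ∀ y : MvPowerSeries (Fin n) ℝ ⧸ I, ∃ (r : ℝ) (y' : MvPowerSeries (Fin n) ℝ ⧸ I),
      y = r • 1 + z * y' := by
    intro y
    obtain ⟨P, rfl⟩ := Ideal.Quotient.mk_surjective y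
    have hmem : P - C (constantCoeff P) ∈ I ⊔ Ideal.span {ν} :=
      mem_of_constantCoeff_eq_zero hX (by simp)
    obtain ⟨u, hu, v, hv, huv⟩ := Submodule.mem_sup.1 hmem
    obtain ⟨w, rfl⟩ := Ideal.mem_span_singleton'.1 hv
    refine ⟨constantCoeff P, Ideal.Quotient.mk I w, ?_⟩
    have hC : (constantCoeff P) • (1 : MvPowerSeries (Fin n) ℝ ⧸ I) =
        Ideal.Quotient.mk I (C (constantCoeff P)) := by
      rw [← mul_one (C (constantCoeff P)), ← smul_eq_C_mul]; rfl
    rw [hC, hz, ← map_mul, ← map_add, Ideal.Quotient.eq]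
    have : P - (C (constantCoeff P) + ν * w) = u := by linear_combination -huv
    rwa [this]
  set S : Finset (MvPowerSeries (Fin n) ℝ ⧸ I) := (Finset.range m).image (z ^ ·) with hS
  have hspan : ∀ N ≤ m, ∀ y : MvPowerSeries (Fin n) ℝ ⧸ I, ∃ y',
      y - z ^ N * y' ∈ Submodule.span ℝ (S : Set (MvPowerSeries (Fin n) ℝ ⧸ I)) := by
    intro N
    induction N with
    | zero => intro _ y; exact ⟨y, by simp⟩
    | succ N ih =>
      intro hN y
      obtain ⟨y', hy'⟩ := ih (by omega) y
      obtain ⟨r, y'', h⟩ := hdiv y'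
      refine ⟨y'', ?_⟩
      have : y - z ^ (N + 1) * y'' = (y - z ^ N * y') + r • z ^ N := by
        rw [h, mul_add, mul_smul_comm, mul_one]; ring
      rw [this]
      refine Submodule.add_mem _ hy' (Submodule.smul_mem _ _ (Submodule.subset_span ?_))
      exact Finset.mem_coe.2 (Finset.mem_image_of_mem _ (Finset.mem_range.2 (by omega)))
  have htop : Submodule.span ℝ (S : Set (MvPowerSeries (Fin n) ℝ ⧸ I)) = ⊤ := by
    refine eq_top_iff.2 fun y _ => ?_
    obtain ⟨y', hy'⟩ := hspan m le_rfl y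
    simpa [hzm] using hy'
  have hrank : Module.rank ℝ (MvPowerSeries (Fin n) ℝ ⧸ I) ≤ (m : Cardinal) := by
    have h1 := rank_span_finset_le (R := ℝ) S
    rw [htop, rank_top] at h1
    refine h1.trans (Nat.cast_le.2 ?_)
    exact Finset.card_image_le.trans (Finset.card_range m).le
  simpa using Cardinal.toENat.monotone' hrank

end LocalAlgebra

/-! ### Linear algebra of the exponent matrix -/

section Exponents

variable {n : ℕ}

theorem Matrix.exists_right_inverse_of_rank_eq {ι κ : Type*} [Fintype ι] [Fintype κ]
    [DecidableEq ι] [DecidableEq κ] (M : Matrix ι κ ℝ) (hM : M.rank = Fintype.card ι) :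
    ∃ C : Matrix κ ι ℝ, M * C = 1 := by
  rw [← Matrix.mulVec_surjective_iff_exists_right_inverse]
  have h : LinearMap.range M.mulVecLin = ⊤ :=
    Submodule.eq_top_of_finrank_eq (by simpa [Matrix.rank] using hM)
  exact LinearMap.range_eq_top.1 h

/-- The rows of `B`, together with the row of ones, are linearly independent. -/
theorem exists_right_inverse_withOnesRow {B : Matrix (Fin n) (Fin (n + 2)) ℝ}
    (hB : Module.finrank ℝ (LinearMap.ker (withOnesRow B).mulVecLin) = 1) :
    ∃ C : Matrix (Fin (n + 2)) (Fin n ⊕ Unit) ℝ, withOnesRow B * C = 1 := by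
  refine Matrix.exists_right_inverse_of_rank_eq _ ?_
  have h := LinearMap.finrank_range_add_finrank_ker (withOnesRow B).mulVecLin
  rw [hB, Module.finrank_pi, Fintype.card_fin] at h
  simp only [Matrix.rank, Fintype.card_sum, Fintype.card_fin, Fintype.card_unit]
  omega

theorem mem_ker_withOnesRow {m : ℕ} {B : Matrix (Fin n) (Fin m) ℝ} {b : Fin m → ℝ} :
    b ∈ LinearMap.ker (withOnesRow B).mulVecLin ↔ (∀ l, ∑ j, B l j * b j = 0) ∧ ∑ j, b j = 0 := by
  rw [LinearMap.mem_ker, funext_iff, Sum.forall]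
  simp [withOnesRow, Matrix.mulVec, dotProduct]

theorem withOnesRow_mul_eq_one_col {m : ℕ} {B : Matrix (Fin n) (Fin m) ℝ}
    {C : Matrix (Fin m) (Fin n ⊕ Unit) ℝ} (h : withOnesRow B * C = 1) (l : Fin n) :
    (∀ i, ∑ j, B i j * C j (Sum.inl l) = if i = l then 1 else 0) ∧ ∑ j, C j (Sum.inl l) = 0 := by
  constructor
  · intro i
    have := congrFun (congrFun h (Sum.inl i)) (Sum.inl l)
    simpa [withOnesRow, Matrix.mul_apply, Matrix.one_apply] using this
  · have := congrFun (congrFun h (Sum.inr ())) (Sum.inl l)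
    simpa [withOnesRow, Matrix.mul_apply] using this

end Exponents

/-! ### The multiplicity of a solution -/

section Multiplicity

variable {n : ℕ}

theorem genMonomial_pos {x : Fin n → ℝ} (hx : ∀ i, 0 < x i) (y : Fin n → ℝ) :
    0 < genMonomial x y :=
  Finset.prod_pos fun i _ => Real.rpow_pos_of_pos (hx i) _

theorem log_genMonomial {x : Fin n → ℝ} (hx : ∀ i, 0 < x i) (y : Fin n → ℝ) :
    Real.log (genMonomial x y) = ∑ i, y i * Real.log (x i) := by
  rw [genMonomial, Real.log_prod fun i _ => (Real.rpow_pos_of_pos (hx i) _).ne']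
  exact Finset.sum_congr rfl fun i _ => Real.log_rpow (hx i) _

theorem analyticAt_coord (a : Fin n → ℝ) (l : Fin n) :
    AnalyticAt ℝ (fun x : Fin n → ℝ => x l) a :=
  (ContinuousLinearMap.proj (R := ℝ) (φ := fun _ : Fin n => ℝ) l).analyticAt a

theorem eventually_forall_pos {a : Fin n → ℝ} (ha : ∀ i, 0 < a i) :
    ∀ᶠ x : Fin n → ℝ in 𝓝 a, ∀ i, 0 < x i :=
  eventually_all.2 fun i => (continuous_apply i).continuousAt.eventually_const_lt (ha i)

theorem AnalyticAt.real_log {E : Type*} [NormedAddCommGroup E] [NormedSpace ℝ E] {f : E → ℝ}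
    {x : E} (hf : AnalyticAt ℝ f x) (hx : 0 < f x) :
    AnalyticAt ℝ (fun y => Real.log (f y)) x :=
  (analyticAt_log hx).comp hf

theorem analyticAt_genMonomial {a : Fin n → ℝ} (ha : ∀ i, 0 < a i) (y : Fin n → ℝ) :
    AnalyticAt ℝ (fun x => genMonomial x y) a := by
  have h : (fun x => Real.exp (∑ i, y i * Real.log (x i))) =ᶠ[𝓝 a] fun x => genMonomial x y := by
    filter_upwards [eventually_forall_pos ha] with x hx
    rw [← log_genMonomial hx, Real.exp_log (genMonomial_pos hx y)]
  refine AnalyticAt.congr (AnalyticAt.rexp' ?_) h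
  exact Finset.analyticAt_fun_sum _ fun i _ =>
    analyticAt_const.fun_mul ((analyticAt_coord a i).real_log (ha i))

theorem taylorMvSeries_sum_const_mul_mem {ι : Type*} [Fintype ι] {a : Fin n → ℝ}
    {I : Ideal (MvPowerSeries (Fin n) ℝ)} (d : ι → ℝ) {E : ι → (Fin n → ℝ) → ℝ}
    (hE : ∀ j, AnalyticAt ℝ (E j) a) (hI : ∀ j, taylorMvSeries (E j) a ∈ I) :
    taylorMvSeries (fun x => ∑ j, d j * E j x) a ∈ I := by
  rw [taylorMvSeries_sum _ fun j _ => analyticAt_const.fun_mul (hE j)]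
  refine I.sum_mem fun j _ => ?_
  rw [taylorMvSeries_const_mul _ (hE j)]
  exact I.mul_mem_left _ (hI j)


theorem one_add_mul_pos {τ q : ℝ} (hτ : τ ∈ Set.Ioo (-1 : ℝ) 1) (hq : q ∈ Set.Icc (-1 : ℝ) 1) :
    0 < 1 + τ * q := by
  have h1 : |τ * q| < 1 := by
    rw [abs_mul]
    exact (mul_le_of_le_one_right (abs_nonneg τ) (abs_le.2 hq)).trans_lt (abs_lt.2 hτ)
  linarith [(abs_lt.1 h1).1]

theorem IsKernelForm.coeff_pos {A : Matrix (Fin n) (Fin (n + 2)) ℝ} {c q : Fin (n + 2) → ℝ}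
    (hK : IsKernelForm A c q) {τ : ℝ} (hτ : τ ∈ Set.Ioo (-1 : ℝ) 1) (j : Fin (n + 2)) :
    0 < c j * (1 + τ * q j) := by
  have h1 : q j ≤ 1 := hK.first ▸ hK.anti (Fin.zero_le j)
  have h2 : -1 ≤ q j := hK.last ▸ hK.anti (Fin.le_last j)
  exact mul_pos (hK.pos j) (one_add_mul_pos hτ ⟨h2, h1⟩)

/-- If a positive vector `c ∘ (α + β q)` lies in the kernel, then `|β| < α`. -/
theorem IsKernelForm.param_mem {A : Matrix (Fin n) (Fin (n + 2)) ℝ} {c q : Fin (n + 2) → ℝ}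
    (hK : IsKernelForm A c q) {α β : ℝ} (h : ∀ j, 0 < c j * (α + β * q j)) :
    0 < α ∧ β / α ∈ Set.Ioo (-1 : ℝ) 1 := by
  have h0 := pos_of_mul_pos_right (h 0) (hK.pos 0).le
  have h1 := pos_of_mul_pos_right (h (Fin.last _)) (hK.pos _).le
  rw [hK.first] at h0
  rw [hK.last] at h1
  have hα : 0 < α := by linarith
  refine ⟨hα, ?_, ?_⟩
  · rw [lt_div_iff₀ hα]; linarith
  · rw [div_lt_iff₀ hα]; linarith

/-- The multiplicity of a solution is at most the order of vanishing, at the corresponding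
parameter `β / α`, of the univariate function obtained by eliminating all other unknowns. -/
theorem zeroMultiplicity_le {A B : Matrix (Fin n) (Fin (n + 2)) ℝ} (hrank : A.rank = n)
    (hB : Module.finrank ℝ (LinearMap.ker (withOnesRow B).mulVecLin) = 1)
    {c q b : Fin (n + 2) → ℝ} (hK : IsKernelForm A c q)
    (hb : b ∈ LinearMap.ker (withOnesRow B).mulVecLin)
    {a : Fin n → ℝ} (ha : a ∈ positiveSolutions A B) {α β : ℝ}
    (hαβ : ∀ j, genMonomial a (fun l => B l j) = c j * (α + β * q j)) :
    zeroMultiplicity (genPolySystem A B) a ≤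
      analyticOrderAt (fun τ => ∑ j, b j * Real.log (c j * (1 + τ * q j))) (β / α) := by
  obtain ⟨hapos, hasol⟩ := ha
  obtain ⟨R, hR⟩ := Matrix.exists_right_inverse_of_rank_eq A (by simpa using hrank)
  obtain ⟨C, hC⟩ := exists_right_inverse_withOnesRow hB
  obtain ⟨hbB, hb1⟩ := mem_ker_withOnesRow.1 hb
  have hmpos : ∀ j, 0 < genMonomial a (fun l => B l j) := fun j => genMonomial_pos hapos _
  obtain ⟨hα, hτ⟩ := hK.param_mem fun j => hαβ j ▸ hmpos j
  have hc : ∀ j, c j ≠ 0 := fun j => (hK.pos j).ne'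
  set mon : Fin (n + 2) → (Fin n → ℝ) → ℝ := fun j x => genMonomial x (fun l => B l j) with hmon
  set F : Fin n → (Fin n → ℝ) → ℝ := fun i x => genPolySystem A B x i with hF
  set I : Ideal (MvPowerSeries (Fin n) ℝ) :=
    Ideal.span (Set.range fun i => taylorMvSeries (F i) a) with hI
  have hmonan : ∀ j, AnalyticAt ℝ (mon j) a := fun j => analyticAt_genMonomial hapos _
  have hFeq : ∀ i, F i = fun x => ∑ j, A i j * mon j x := fun i => rfl
  have hFan : ∀ i, AnalyticAt ℝ (F i) a := fun i => by
    rw [hFeq]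
    exact Finset.analyticAt_fun_sum _ fun j _ => analyticAt_const.fun_mul (hmonan j)
  have hFI : ∀ i, taylorMvSeries (F i) a ∈ I := fun i => Ideal.subset_span ⟨i, rfl⟩
  have hFa : ∀ i, F i a = 0 := fun i => congrFun hasol i
  -- The monomials, corrected by a combination of the equations so that they lie in `ker A`.
  set Y : Fin (n + 2) → (Fin n → ℝ) → ℝ := fun j x => mon j x - ∑ i, R j i * F i x with hY
  have hYan : ∀ j, AnalyticAt ℝ (Y j) a := fun j => (hmonan j).fun_sub <|
    Finset.analyticAt_fun_sum _ fun i _ => analyticAt_const.fun_mul (hFan i)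
  have hYa : ∀ j, Y j a = mon j a := fun j => by simp [hY, hFa]
  set αf : (Fin n → ℝ) → ℝ := fun x => (Y 0 x / c 0 + Y (Fin.last _) x / c (Fin.last _)) / 2
    with hαf
  set βf : (Fin n → ℝ) → ℝ := fun x => (Y 0 x / c 0 - Y (Fin.last _) x / c (Fin.last _)) / 2
    with hβf
  have hYαβ : ∀ x j, Y j x = c j * (αf x + βf x * q j) := by
    intro x
    have hker : (fun j => Y j x) ∈ LinearMap.ker A.mulVecLin := by
      have h1 : (fun j => Y j x) = (fun j => mon j x) - R.mulVec (genPolySystem A B x) := rfl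
      rw [h1, LinearMap.mem_ker, Matrix.mulVecLin_apply, Matrix.mulVec_sub, Matrix.mulVec_mulVec,
        hR, Matrix.one_mulVec]
      exact sub_self _
    obtain ⟨α', β', h⟩ := (hK.ker_eq _).1 hker
    have h0 := h 0
    have h1 := h (Fin.last _)
    rw [hK.first] at h0
    rw [hK.last] at h1
    have h0' : Y 0 x / c 0 = α' + β' * 1 := by
      rw [div_eq_iff (hc 0)]; exact h0.trans (mul_comm _ _)
    have h1' : Y (Fin.last _) x / c (Fin.last _) = α' + β' * -1 := by
      rw [div_eq_iff (hc _)]; exact h1.trans (mul_comm _ _)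
    have hα' : αf x = α' := by simp only [hαf, h0', h1']; ring
    have hβ' : βf x = β' := by simp only [hβf, h0', h1']; ring
    intro j
    rw [hα', hβ']
    exact h j
  have hαa : αf a = α := by
    simp only [hαf, hYa, hmon, hαβ, mul_div_cancel_left₀ _ (hc _), hK.first, hK.last]; ring
  have hβa : βf a = β := by
    simp only [hβf, hYa, hmon, hαβ, mul_div_cancel_left₀ _ (hc _), hK.first, hK.last]; ring
  have hαan : AnalyticAt ℝ αf a :=
    (((hYan 0).fun_div analyticAt_const (hc _)).fun_add
      ((hYan (Fin.last _)).fun_div analyticAt_const (hc _))).fun_div analyticAt_const two_ne_zero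
  have hβan : AnalyticAt ℝ βf a :=
    (((hYan 0).fun_div analyticAt_const (hc _)).fun_sub
      ((hYan (Fin.last _)).fun_div analyticAt_const (hc _))).fun_div analyticAt_const two_ne_zero
  set τf : (Fin n → ℝ) → ℝ := fun x => βf x / αf x with hτf
  have hτan : AnalyticAt ℝ τf a := hβan.fun_div hαan (by rw [hαa]; exact hα.ne')
  have hτa : τf a = β / α := by simp only [hτf, hαa, hβa]
  have hpos : ∀ᶠ x in 𝓝 a, (∀ i, 0 < x i) ∧ 0 < αf x ∧ τf x ∈ Set.Ioo (-1 : ℝ) 1 :=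
    (eventually_forall_pos hapos).and
      ((hαan.continuousAt.eventually_const_lt (hαa ▸ hα)).and
        (hτan.continuousAt.eventually_mem (isOpen_Ioo.mem_nhds (hτa ▸ hτ))))
  -- The logarithm of the quotient of corrected and actual monomial vanishes modulo the equations.
  set E : Fin (n + 2) → (Fin n → ℝ) → ℝ := fun j x => Real.log (Y j x / mon j x) with hE
  have hratan : ∀ j, AnalyticAt ℝ (fun x => Y j x / mon j x) a := fun j =>
    (hYan j).fun_div (hmonan j) (hmpos j).ne'
  have hrata : ∀ j, Y j a / mon j a = 1 := fun j => by rw [hYa, div_self (hmpos j).ne']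
  have hlog1 : ∀ j, AnalyticAt ℝ Real.log (Y j a / mon j a) := fun j =>
    analyticAt_log (by rw [hrata]; exact one_pos)
  have hEan : ∀ j, AnalyticAt ℝ (E j) a := fun j =>
    (hratan j).real_log (by rw [hrata]; exact one_pos)
  have hEI : ∀ j, taylorMvSeries (E j) a ∈ I := by
    intro j
    refine taylorMvSeries_comp_mem (hratan j) (hlog1 j) (by rw [hrata, Real.log_one]) ?_
    have h1 : (fun x => Y j x / mon j x - Y j a / mon j a) =ᶠ[𝓝 a]
        fun x => ∑ i, R j i * ((mon j x)⁻¹ * - F i x) := by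
      filter_upwards [hpos] with x hx
      have hm : mon j x ≠ 0 := (genMonomial_pos hx.1 _).ne'
      have h2 : Y j x - mon j x = ∑ i, R j i * - F i x := by simp [hY]
      rw [hrata, div_sub_one hm, div_eq_inv_mul, h2, Finset.mul_sum]
      exact Finset.sum_congr rfl fun i _ => by ring
    rw [taylorMvSeries_congr h1]
    have hinv : AnalyticAt ℝ (fun x => (mon j x)⁻¹) a := (hmonan j).fun_inv (hmpos j).ne'
    refine taylorMvSeries_sum_const_mul_mem _ (fun i => hinv.fun_mul (hFan i).fun_neg) fun i => ?_
    rw [taylorMvSeries_mul hinv (hFan i).fun_neg]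
    refine I.mul_mem_left _ ?_
    have : (fun x => - F i x) = fun x => (-1) * F i x := by funext x; ring
    rw [this, taylorMvSeries_const_mul _ (hFan i)]
    exact I.mul_mem_left _ (hFI i)
  have hlogY : ∀ᶠ x in 𝓝 a, ∀ j, ∑ l, B l j * Real.log (x l) =
      Real.log (αf x) + Real.log (c j * (1 + τf x * q j)) - E j x := by
    filter_upwards [hpos] with x hx j
    obtain ⟨hx0, hx1, hx2⟩ := hx
    have hcτ := hK.coeff_pos hx2 j
    have hYx : Y j x = αf x * (c j * (1 + τf x * q j)) := by
      rw [hYαβ]; simp only [hτf]; field_simp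
    have hYpos : 0 < Y j x := by rw [hYx]; exact mul_pos hx1 hcτ
    simp only [hE]
    rw [← Real.log_mul hx1.ne' hcτ.ne', ← hYx, Real.log_div hYpos.ne' (genMonomial_pos hx0 _).ne',
      log_genMonomial hx0]
    ring
  set g : ℝ → ℝ := fun τ => ∑ j, b j * Real.log (c j * (1 + τ * q j)) with hg
  have hlogan : ∀ j, AnalyticAt ℝ (fun τ => Real.log (c j * (1 + τ * q j))) (β / α) := fun j =>
    (analyticAt_const.fun_mul (analyticAt_const.fun_add
      (analyticAt_id.fun_mul analyticAt_const))).real_log (hK.coeff_pos hτ j)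
  have hgan : AnalyticAt ℝ g (β / α) :=
    Finset.analyticAt_fun_sum _ fun j _ => analyticAt_const.fun_mul (hlogan j)
  -- Eliminating `x` and `α` shows that `g ∘ τf` lies in the ideal of the equations.
  have hgI : taylorMvSeries (fun x => g (τf x)) a ∈ I := by
    have h1 : (fun x => g (τf x)) =ᶠ[𝓝 a] fun x => ∑ j, b j * E j x := by
      filter_upwards [hlogY] with x hx
      have h2 : ∑ j, b j * ∑ l, B l j * Real.log (x l) = 0 := by
        simp only [Finset.mul_sum]
        rw [Finset.sum_comm]
        refine Finset.sum_eq_zero fun l _ => ?_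
        calc ∑ j, b j * (B l j * Real.log (x l)) = (∑ j, B l j * b j) * Real.log (x l) := by
              rw [Finset.sum_mul]; exact Finset.sum_congr rfl fun j _ => by ring
          _ = 0 := by rw [hbB, zero_mul]
      have h3 : ∑ j, b j * ∑ l, B l j * Real.log (x l) =
          (∑ j, b j) * Real.log (αf x) + g (τf x) - ∑ j, b j * E j x := by
        rw [Finset.sum_mul, ← Finset.sum_add_distrib, ← Finset.sum_sub_distrib]
        exact Finset.sum_congr rfl fun j _ => by rw [hx j]; ring
      rw [h2, hb1] at h3
      linarith
    rw [taylorMvSeries_congr h1]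
    exact taylorMvSeries_sum_const_mul_mem _ hEan hEI
  set ν := taylorMvSeries (fun x => τf x - τf a) a with hν
  have hνmem : ν ∈ I ⊔ Ideal.span {ν} :=
    Ideal.mem_sup_right (Ideal.mem_span_singleton_self ν)
  have hX : ∀ l, MvPowerSeries.X l ∈ I ⊔ Ideal.span {ν} := by
    intro l
    obtain ⟨hCB, hC1⟩ := withOnesRow_mul_eq_one_col hC l
    have hxan := analyticAt_coord a l
    have hlxan : AnalyticAt ℝ (fun x : Fin n → ℝ => Real.log (x l)) a :=
      hxan.real_log (hapos l)
    set H : ℝ → ℝ := fun t => ∑ j, C j (Sum.inl l) * Real.log (c j * (1 + t * q j)) with hH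
    have hHan : AnalyticAt ℝ H (τf a) := by
      rw [hτa]
      exact Finset.analyticAt_fun_sum _ fun j _ => analyticAt_const.fun_mul (hlogan j)
    have h1 : ∀ᶠ x in 𝓝 a, Real.log (x l) = H (τf x) + ∑ j, -C j (Sum.inl l) * E j x := by
      filter_upwards [hlogY] with x hx
      have h2 : ∑ j, C j (Sum.inl l) * ∑ i, B i j * Real.log (x i) = Real.log (x l) := by
        simp only [Finset.mul_sum]
        rw [Finset.sum_comm]
        have : ∀ i, ∑ j, C j (Sum.inl l) * (B i j * Real.log (x i)) =
            (if i = l then 1 else 0) * Real.log (x i) := fun i => by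
          rw [← hCB i, Finset.sum_mul]
          exact Finset.sum_congr rfl fun j _ => by ring
        simp [this]
      have h3 : ∑ j, C j (Sum.inl l) * ∑ i, B i j * Real.log (x i) =
          (∑ j, C j (Sum.inl l)) * Real.log (αf x) + H (τf x) +
            ∑ j, -C j (Sum.inl l) * E j x := by
        rw [Finset.sum_mul, ← Finset.sum_add_distrib, ← Finset.sum_add_distrib]
        exact Finset.sum_congr rfl fun j _ => by rw [hx j]; ring
      rw [← h2, h3, hC1]
      ring
    have hEa : ∀ j, E j a = 0 := fun j => by simp only [hE, hrata, Real.log_one]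
    have h2 : (fun x : Fin n → ℝ => Real.log (x l) - Real.log (a l)) =ᶠ[𝓝 a]
        fun x => (H (τf x) - H (τf a)) + ∑ j, -C j (Sum.inl l) * E j x := by
      have h3 := h1.self_of_nhds
      filter_upwards [h1] with x hx
      rw [hx, h3]
      simp only [hEa, mul_zero, Finset.sum_const_zero]
      ring
    have hlog : taylorMvSeries (fun x : Fin n → ℝ => Real.log (x l) - Real.log (a l)) a ∈
        I ⊔ Ideal.span {ν} := by
      rw [taylorMvSeries_congr h2,
        taylorMvSeries_add (f := fun x => H (τf x) - H (τf a))
          ((hHan.fun_comp hτan).fun_sub analyticAt_const)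
          (Finset.analyticAt_fun_sum _ fun j _ => analyticAt_const.fun_mul (hEan j))]
      refine add_mem ?_ (Ideal.mem_sup_left (taylorMvSeries_sum_const_mul_mem _ hEan hEI))
      exact taylorMvSeries_comp_mem (φ := fun t => H t - H (τf a)) hτan
        (hHan.fun_sub analyticAt_const) (sub_self _) hνmem
    have h4 := taylorMvSeries_comp_mem (φ := fun s => Real.exp s - a l) hlxan
      (analyticAt_id.rexp'.fun_sub analyticAt_const) (by
        simp [Real.exp_log (hapos l)]) hlog
    have h5 : (fun x : Fin n → ℝ => Real.exp (Real.log (x l)) - a l) =ᶠ[𝓝 a]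
        fun x => x l - a l := by
      filter_upwards [hpos] with x hx
      rw [Real.exp_log (hx.1 l)]
    rw [taylorMvSeries_congr h5, taylorMvSeries_sub_const hxan, taylorMvSeries_coord] at h4
    simpa using h4
  rcases eq_or_ne (analyticOrderAt g (β / α)) ⊤ with htop | htop
  · rw [htop]; exact le_top
  · obtain ⟨m, hm⟩ := ENat.ne_top_iff_exists.1 htop
    obtain ⟨ψ, hψan, hψ0, hψ⟩ := hgan.analyticOrderAt_eq_natCast.1 hm.symm
    rw [← hm]
    refine MvPowerSeries.toENat_rank_quotient_le hX ?_
    rw [← hτa] at hψan hψ hψ0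
    rw [taylorMvSeries_comp_eq hτan hψan hψ] at hgI
    have hunit : IsUnit (taylorMvSeries (fun x => ψ (τf x)) a) := by
      rw [MvPowerSeries.isUnit_iff_constantCoeff, constantCoeff_taylorMvSeries]
      exact hψ0.isUnit
    exact (Ideal.mul_unit_mem_iff_mem I hunit).1 hgI

end Multiplicity

/-! ### Sign changes and cut points -/

section SignChanges

theorem List.length_destutter_cons_cons {α : Type*} [DecidableEq α] (a b : α) (l : List α) :
    ((a :: b :: l).destutter (· ≠ ·)).length - 1 =
      ((b :: l).destutter (· ≠ ·)).length - 1 + if a = b then 0 else 1 := by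
  rw [List.destutter_cons_cons]
  by_cases h : a = b
  · subst h; simp [List.destutter_cons']
  · have : 0 < (List.destutter' (· ≠ ·) b l).length :=
      List.length_pos_iff.2 (List.destutter'_ne_nil _ _)
    rw [if_pos h, if_neg h, List.length_cons, List.destutter_cons']
    omega

/-- Let a function on an interval be constant, with value `L[i]`, on the block `[Q (i+1), Q i)`.
There is one cut point per sign change of `L` such that the product of the function with
`∏ (x - ρ)`, over all cut points `ρ`, has everywhere the sign of the first nonzero `L[i]`. -/
theorem exists_cut_points (L : List ℝ) (Q : ℕ → ℝ) (hQ : Antitone Q) :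
    ∃ R : List ℝ,
      R.length =
        (((L.map SignType.sign).filter (· ≠ 0)).destutter (· ≠ ·)).length - 1 ∧
      (∀ ρ ∈ R, ∃ i, 1 ≤ i ∧ i ≤ L.length ∧ ρ = Q i) ∧
      ∀ ε ∈ ((L.map SignType.sign).filter (· ≠ 0)).head?,
        ∀ (i : ℕ) (hi : i < L.length) (x : ℝ), Q (i + 1) ≤ x → x < Q i →
          0 ≤ (ε : ℝ) * L[i] * (R.map (x - ·)).prod := by
  induction L generalizing Q with
  | nil => exact ⟨[], rfl, by simp, by simp⟩
  | cons a L ih =>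
    obtain ⟨R, hlen, hR, hsign⟩ := ih (fun i => Q (i + 1)) fun i j h => hQ (by omega)
    have hR' : ∀ ρ ∈ R, ∃ i, 1 ≤ i ∧ i ≤ (a :: L).length ∧ ρ = Q i := fun ρ hρ => by
      obtain ⟨i, h1, h2, h3⟩ := hR ρ hρ
      exact ⟨i + 1, by omega, by simpa using h2, h3⟩
    have hprod : ∀ x, Q 1 ≤ x → 0 ≤ (R.map (x - ·)).prod := fun x hx => by
      refine List.prod_nonneg fun y hy => ?_
      obtain ⟨ρ, hρ, rfl⟩ := List.mem_map.1 hy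
      obtain ⟨i, h1, -, h3⟩ := hR' ρ hρ
      have := hQ h1
      rw [h3]
      linarith
    rcases eq_or_ne a 0 with rfl | ha
    · refine ⟨R, by simpa using hlen, hR', fun ε hε i hi x h1 h2 => ?_⟩
      cases i with
      | zero => simp
      | succ i =>
        exact hsign ε (by simpa using hε) i (by simpa using hi) x h1 h2
    · have hsa : SignType.sign a ≠ 0 := sign_ne_zero.2 ha
      have habs : 0 ≤ ((SignType.sign a : SignType) : ℝ) * a := by
        rw [sign_mul_self]; exact abs_nonneg a
      have hfil : ((a :: L).map SignType.sign).filter (· ≠ 0) =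
          SignType.sign a :: (L.map SignType.sign).filter (· ≠ 0) := by
        simp [ha]
      rw [hfil]
      cases hl : (L.map SignType.sign).filter (· ≠ 0) with
      | nil =>
        refine ⟨[], by simp, by simp, fun ε hε i hi x h1 h2 => ?_⟩
        obtain rfl : SignType.sign a = ε := by simpa using hε
        cases i with
        | zero => simp
        | succ i =>
          have h0 : L[i]'(by simpa using hi) = 0 := by
            by_contra hne
            have : SignType.sign (L[i]'(by simpa using hi)) ∈
                (L.map SignType.sign).filter (· ≠ 0) := by
              simp only [List.mem_filter, List.mem_map]
              exact ⟨⟨_, List.getElem_mem _, rfl⟩, by simpa using hne⟩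
            rw [hl] at this
            simp at this
          simp [h0]
      | cons b t =>
        rw [hl] at hlen hsign
        rw [List.length_destutter_cons_cons, ← hlen]
        by_cases hab : SignType.sign a = b
        · refine ⟨R, by simp [hab], hR', fun ε hε i hi x h1 h2 => ?_⟩
          obtain rfl : SignType.sign a = ε := by simpa using hε
          cases i with
          | zero => exact mul_nonneg habs (hprod x h1)
          | succ i => exact hsign _ (by simp [hab]) i (by simpa using hi) x h1 h2
        · refine ⟨Q 1 :: R, by simp [hab], ?_, fun ε hε i hi x h1 h2 => ?_⟩
          · intro ρ hρ
            rcases List.mem_cons.1 hρ with rfl | hρ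
            · exact ⟨1, le_rfl, by simp, rfl⟩
            · exact hR' ρ hρ
          obtain rfl : SignType.sign a = ε := by simpa using hε
          rw [List.map_cons, List.prod_cons]
          cases i with
          | zero => exact mul_nonneg habs (mul_nonneg (sub_nonneg.2 h1) (hprod x h1))
          | succ i =>
            have h3 := hsign b (by simp) i (by simpa using hi) x h1 h2
            have hb0 : b ≠ 0 := by
              have : b ∈ (L.map SignType.sign).filter (· ≠ 0) := by rw [hl]; simp
              simpa using (List.mem_filter.1 this).2
            have hneg : ((SignType.sign a : SignType) : ℝ) = -(b : ℝ) := by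
              generalize SignType.sign a = s at *
              revert hab hsa hb0
              cases s <;> cases b <;> simp
            have hx : x < Q 1 := h2.trans_le (hQ (by omega))
            rw [hneg, List.getElem_cons_succ]
            have := mul_nonneg (sub_nonneg.2 hx.le) h3
            nlinarith [this]

end SignChanges

/-! ### Zeros of integrals against powers of `(1 + τ q)⁻¹` -/

section Descartes

open MeasureTheory Set

/-- Rolle's theorem, counting zeros with multiplicity. -/
theorem sum_analyticOrderAt_le_of_deriv {f : ℝ → ℝ} {s : Set ℝ} [hs : s.OrdConnected]
    (hf : AnalyticOnNhd ℝ f s) {v : ℕ}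
    (h : ∀ S : Finset ℝ, ↑S ⊆ s → ∑ x ∈ S, analyticOrderAt (deriv f) x ≤ v)
    (S : Finset ℝ) (hS : ↑S ⊆ s) : ∑ x ∈ S, analyticOrderAt f x ≤ (v + 1 : ℕ) := by
  classical
  have hone : ∀ x ∈ s, deriv f x = 0 → 1 ≤ analyticOrderAt (deriv f) x := fun x hx h0 =>
    Order.one_le_iff_ne_zero.2 (analyticOrderAt_ne_zero.2 ⟨(hf x hx).deriv, h0⟩)
  have hfin : {x ∈ s | deriv f x = 0}.Finite := by
    by_contra hinf
    obtain ⟨T, hT, hcard⟩ := Set.Infinite.exists_subset_card_eq hinf (v + 1)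
    have h1 := h T fun x hx => (hT hx).1
    have h2 : ∑ x ∈ T, (1 : ℕ∞) ≤ ∑ x ∈ T, analyticOrderAt (deriv f) x :=
      Finset.sum_le_sum fun x hx => hone x (hT hx).1 (hT hx).2
    have h3 := h2.trans h1
    rw [Finset.sum_const, hcard, nsmul_one, Nat.cast_le] at h3
    omega
  set S₀ := S.filter (f · = 0) with hS₀
  have hS₀s : ∀ x ∈ S₀, x ∈ s := fun x hx => hS (Finset.mem_of_mem_filter x hx)
  have hS₀0 : ∀ x ∈ S₀, f x = 0 := fun x hx => (Finset.mem_filter.1 hx).2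
  set T := hfin.toFinset with hT
  have hTs : ∀ x ∈ T, x ∈ s ∧ deriv f x = 0 := fun x hx => hfin.mem_toFinset.1 hx
  have hinter : S₀.card ≤ (T \ S₀).card + 1 := by
    refine Finset.card_le_sdiff_of_interleaved fun x hx y hy hxy _ => ?_
    have hsub : Icc x y ⊆ s := hs.out (hS₀s x hx) (hS₀s y hy)
    obtain ⟨z, hz, hz0⟩ := exists_deriv_eq_zero hxy
      (fun z hz => (hf z (hsub hz)).continuousAt.continuousWithinAt)
      ((hS₀0 x hx).trans (hS₀0 y hy).symm)
    exact ⟨z, hfin.mem_toFinset.2 ⟨hsub (Ioo_subset_Icc_self hz), hz0⟩, hz.1, hz.2⟩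
  have h1 : ∑ x ∈ S, analyticOrderAt f x = ∑ x ∈ S₀, analyticOrderAt f x := by
    rw [hS₀, Finset.sum_filter_of_ne]
    exact fun x _ hx => apply_eq_zero_of_analyticOrderAt_ne_zero hx
  have h2 : ∀ x ∈ S₀, analyticOrderAt f x = analyticOrderAt (deriv f) x + 1 := fun x hx => by
    rw [(hf x (hS₀s x hx)).analyticOrderAt_deriv_add_one, hS₀0 x hx]
    simp
  have h3 : ∑ x ∈ S₀, analyticOrderAt (deriv f) x + ((T \ S₀).card : ℕ∞) ≤ v := by
    refine le_trans ?_ (h (S₀ ∪ T \ S₀) ?_)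
    · rw [Finset.sum_union Finset.disjoint_sdiff]
      gcongr
      rw [Finset.card_eq_sum_ones, Nat.cast_sum]
      refine Finset.sum_le_sum fun x hx => ?_
      have hx := hTs x (Finset.mem_sdiff.1 hx).1
      simpa using hone x hx.1 hx.2
    · intro x hx
      rcases Finset.mem_union.1 hx with hx | hx
      exacts [hS₀s x hx, (hTs x (Finset.mem_sdiff.1 hx).1).1]
  rw [h1, Finset.sum_congr rfl h2, Finset.sum_add_distrib, Finset.sum_const, nsmul_one]
  calc ∑ x ∈ S₀, analyticOrderAt (deriv f) x + (S₀.card : ℕ∞)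
      ≤ ∑ x ∈ S₀, analyticOrderAt (deriv f) x + (((T \ S₀).card + 1 : ℕ) : ℕ∞) := by
        gcongr
    _ ≤ (v + 1 : ℕ) := by
        push_cast
        rw [← add_assoc]
        gcongr

theorem continuousOn_inv_one_add_mul_pow {τ : ℝ} (hτ : τ ∈ Ioo (-1 : ℝ) 1) (N : ℕ) :
    ContinuousOn (fun q : ℝ => ((1 + τ * q) ^ N)⁻¹) (Icc (-1) 1) :=
  ContinuousOn.inv₀ (by fun_prop) fun _ hq => (pow_pos (one_add_mul_pos hτ hq) N).ne'

theorem integrableOn_mul_inv_one_add_mul_pow {w : ℝ → ℝ} (hw : IntegrableOn w (Icc (-1) 1))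
    {τ : ℝ} (hτ : τ ∈ Ioo (-1 : ℝ) 1) (N : ℕ) :
    IntegrableOn (fun q => w q * ((1 + τ * q) ^ N)⁻¹) (Icc (-1) 1) :=
  hw.mul_continuousOn (continuousOn_inv_one_add_mul_pow hτ N) isCompact_Icc

theorem hasDerivAt_integral_mul_inv_one_add_mul_pow {w : ℝ → ℝ}
    (hw : IntegrableOn w (Icc (-1) 1)) {τ : ℝ} (hτ : τ ∈ Ioo (-1 : ℝ) 1) (N : ℕ) :
    HasDerivAt (fun τ => ∫ q in Icc (-1 : ℝ) 1, w q * ((1 + τ * q) ^ (N + 1))⁻¹)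
      (∫ q in Icc (-1 : ℝ) 1, w q * (-((N + 1 : ℕ) : ℝ) * q) * ((1 + τ * q) ^ (N + 2))⁻¹) τ := by
  obtain ⟨r, hr1, hr2⟩ := exists_between (abs_lt.2 hτ)
  have hs : Ioo (-r) r ∈ 𝓝 τ := isOpen_Ioo.mem_nhds (abs_lt.1 hr1)
  have hsub : Ioo (-r) r ⊆ Ioo (-1 : ℝ) 1 := Ioo_subset_Ioo (by linarith) hr2.le
  have hlow : ∀ t ∈ Ioo (-r) r, ∀ q ∈ Icc (-1 : ℝ) 1, 1 - r ≤ 1 + t * q := by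
    intro t ht q hq
    have h1 : |t * q| ≤ r := by
      rw [abs_mul]
      exact (mul_le_of_le_one_right (abs_nonneg t) (abs_le.2 hq)).trans (abs_lt.2 ht).le
    linarith [(abs_le.1 h1).1]
  have hw' : IntegrableOn (fun q => w q * (-((N + 1 : ℕ) : ℝ) * q)) (Icc (-1) 1) :=
    hw.mul_continuousOn (by fun_prop) isCompact_Icc
  refine (hasDerivAt_integral_of_dominated_loc_of_deriv_le (μ := volume.restrict (Icc (-1 : ℝ) 1))
    (F := fun t q => w q * ((1 + t * q) ^ (N + 1))⁻¹)
    (F' := fun t q => w q * (-((N + 1 : ℕ) : ℝ) * q) * ((1 + t * q) ^ (N + 2))⁻¹)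
    (bound := fun q => ‖w q * (-((N + 1 : ℕ) : ℝ) * q)‖ * ((1 - r) ^ (N + 2))⁻¹)
    hs ?_ (integrableOn_mul_inv_one_add_mul_pow hw hτ _)
    (integrableOn_mul_inv_one_add_mul_pow hw' hτ _).aestronglyMeasurable ?_
    (hw'.norm.mul_const _) ?_).2
  · filter_upwards [hs] with t ht
    exact (integrableOn_mul_inv_one_add_mul_pow hw (hsub ht) _).aestronglyMeasurable
  · refine (ae_restrict_iff' measurableSet_Icc).2 (Eventually.of_forall fun q hq t ht => ?_)
    have hpos : 0 < 1 - r := by linarith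
    rw [norm_mul]
    gcongr
    rw [norm_inv, norm_pow]
    gcongr
    exact (hlow t ht q hq).trans (le_abs_self _)
  · refine (ae_restrict_iff' measurableSet_Icc).2 (Eventually.of_forall fun q hq t ht => ?_)
    have hne : 1 + t * q ≠ 0 := (one_add_mul_pos (hsub ht) hq).ne'
    have h1 : HasDerivAt (fun t : ℝ => 1 + t * q) q t := by
      simpa using ((hasDerivAt_id t).mul_const q).const_add 1
    refine (((h1.fun_pow (N + 1)).fun_inv (pow_ne_zero _ hne)).const_mul (w q)).congr_deriv ?_
    rw [Nat.add_sub_cancel]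
    field_simp
    ring

theorem analyticOrderAt_mul_of_ne_zero {u f : ℝ → ℝ} {x : ℝ} (hu : AnalyticAt ℝ u x)
    (hu0 : u x ≠ 0) (hf : AnalyticAt ℝ f x) :
    analyticOrderAt (fun t => u t * f t) x = analyticOrderAt f x := by
  have h := analyticOrderAt_mul hu hf
  rw [hu.analyticOrderAt_eq_zero.2 hu0, zero_add] at h
  exact h

/-- Descartes' rule of signs for the kernel `(1 + τ q)⁻¹ ^ (N + 1)`: if `w` becomes of constant
sign after multiplication by `∏ (q - ρ)`, with `ρ` running through `R`, then the integral of `w`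
against the kernel has at most `R.length` zeros in `(-1, 1)`, counted with multiplicity.

Multiplying the integral by `(1 + τ ρ) ^ (N + 1)` and differentiating in `τ` yields, up to a
nonvanishing factor, the integral of `w q * (q - ρ)` against the next power of the kernel. -/
theorem sum_analyticOrderAt_integral_le (R : List ℝ) (hR : ∀ ρ ∈ R, ρ ∈ Icc (-1 : ℝ) 1)
    {w : ℝ → ℝ} (hw : IntegrableOn w (Icc (-1) 1))
    (hw0 : ¬ w =ᵐ[volume.restrict (Icc (-1 : ℝ) 1)] 0) (N : ℕ) {f : ℝ → ℝ}
    (hf : AnalyticOnNhd ℝ f (Ioo (-1) 1))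
    (hfw : ∀ τ ∈ Ioo (-1 : ℝ) 1,
      f τ = ∫ q in Icc (-1 : ℝ) 1, w q * ((1 + τ * q) ^ (N + 1))⁻¹)
    {ε : ℝ} (hε : ε ≠ 0)
    (hsign : ∀ q ∈ Icc (-1 : ℝ) 1, 0 ≤ ε * w q * (R.map (q - ·)).prod)
    (S : Finset ℝ) (hS : ↑S ⊆ Ioo (-1 : ℝ) 1) :
    ∑ x ∈ S, analyticOrderAt f x ≤ (R.length : ℕ) := by
  induction R generalizing w N f S with
  | nil =>
    refine (Finset.sum_eq_zero fun τ hτ => ?_).le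
    have hτ := hS hτ
    refine (hf τ hτ).analyticOrderAt_eq_zero.2 fun h0 => hw0 ?_
    rw [hfw τ hτ] at h0
    have h1 : ∫ q in Icc (-1 : ℝ) 1, ε * (w q * ((1 + τ * q) ^ (N + 1))⁻¹) = 0 := by
      rw [integral_const_mul, h0, mul_zero]
    have hnn : ∀ q ∈ Icc (-1 : ℝ) 1, 0 ≤ ε * (w q * ((1 + τ * q) ^ (N + 1))⁻¹) := by
      intro q hq
      rw [← mul_assoc]
      exact mul_nonneg (by simpa using hsign q hq)
        (inv_nonneg.2 (pow_pos (one_add_mul_pos hτ hq) _).le)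
    rw [setIntegral_eq_zero_iff_of_nonneg_ae
      ((ae_restrict_iff' measurableSet_Icc).2 (Eventually.of_forall hnn))
      ((integrableOn_mul_inv_one_add_mul_pow hw hτ _).const_mul ε)] at h1
    filter_upwards [h1, ae_restrict_mem measurableSet_Icc] with q hq hqI
    simpa [hε, (one_add_mul_pos hτ hqI).ne'] using hq
  | cons ρ R ih =>
    have hρ := hR ρ (by simp)
    set w' : ℝ → ℝ := fun q => w q * (q - ρ) with hw'
    have hw'int : IntegrableOn w' (Icc (-1) 1) :=
      hw.mul_continuousOn (by fun_prop) isCompact_Icc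
    have hw'0 : ¬ w' =ᵐ[volume.restrict (Icc (-1 : ℝ) 1)] 0 := by
      intro h
      refine hw0 ?_
      have hne : ∀ᵐ q : ℝ ∂(volume.restrict (Icc (-1 : ℝ) 1)), q ≠ ρ :=
        ae_restrict_of_ae (Measure.ae_ne volume ρ)
      filter_upwards [h, hne] with q hq hqρ
      simpa [hw', sub_ne_zero.2 hqρ] using hq
    set p : ℝ → ℝ := fun τ => (1 + τ * ρ) ^ (N + 1) with hp
    have hlin : ∀ τ, AnalyticAt ℝ (fun τ : ℝ => 1 + τ * ρ) τ := fun τ =>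
      analyticAt_const.fun_add (analyticAt_id.fun_mul analyticAt_const)
    have hpan : ∀ τ, AnalyticAt ℝ p τ := fun τ => (hlin τ).fun_pow _
    set h : ℝ → ℝ := fun τ => p τ * f τ with hh
    have hhan : AnalyticOnNhd ℝ h (Ioo (-1) 1) := fun τ hτ => (hpan τ).fun_mul (hf τ hτ)
    set u : ℝ → ℝ := fun τ => -((N + 1 : ℕ) : ℝ) * (1 + τ * ρ) ^ N with hu
    have huan : ∀ τ, AnalyticAt ℝ u τ := fun τ => analyticAt_const.fun_mul ((hlin τ).fun_pow _)
    have hu0 : ∀ τ ∈ Ioo (-1 : ℝ) 1, u τ ≠ 0 := fun τ hτ =>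
      mul_ne_zero (neg_ne_zero.2 (by positivity)) (pow_pos (one_add_mul_pos hτ hρ) _).ne'
    set f' : ℝ → ℝ := fun τ => (u τ)⁻¹ * deriv h τ with hf'
    have hf'an : AnalyticOnNhd ℝ f' (Ioo (-1) 1) := fun τ hτ =>
      ((huan τ).fun_inv (hu0 τ hτ)).fun_mul (hhan τ hτ).deriv
    have hf'w : ∀ τ ∈ Ioo (-1 : ℝ) 1,
        f' τ = ∫ q in Icc (-1 : ℝ) 1, w' q * ((1 + τ * q) ^ (N + 1 + 1))⁻¹ := by
      intro τ hτ
      have h1 : HasDerivAt f _ τ :=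
        (hasDerivAt_integral_mul_inv_one_add_mul_pow hw hτ N).congr_of_eventuallyEq
          (by filter_upwards [isOpen_Ioo.mem_nhds hτ] with t ht using hfw t ht)
      have h2 : HasDerivAt p (((N + 1 : ℕ) : ℝ) * (1 + τ * ρ) ^ N * ρ) τ := by
        have h3 : HasDerivAt (fun t : ℝ => 1 + t * ρ) ρ τ := by
          simpa using ((hasDerivAt_id τ).mul_const ρ).const_add 1
        simpa using h3.fun_pow (N + 1)
      have hw2 : IntegrableOn (fun q => w q * (-((N + 1 : ℕ) : ℝ) * q)) (Icc (-1) 1) :=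
        hw.mul_continuousOn (by fun_prop) isCompact_Icc
      simp only [hf']
      rw [inv_mul_eq_iff_eq_mul₀ (hu0 τ hτ), (h2.fun_mul h1).deriv, hfw τ hτ,
        ← integral_const_mul, ← integral_const_mul, ← integral_const_mul, ← integral_add
          ((integrableOn_mul_inv_one_add_mul_pow hw hτ _).const_mul _)
          ((integrableOn_mul_inv_one_add_mul_pow hw2 hτ _).const_mul _)]
      refine setIntegral_congr_fun measurableSet_Icc fun q hq => ?_
      have hne : 1 + τ * q ≠ 0 := (one_add_mul_pos hτ hq).ne'
      simp only [hu, hw', hp]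
      field_simp
      ring
    have key := sum_analyticOrderAt_le_of_deriv hhan (v := R.length) (fun T hT => by
      refine le_trans (Finset.sum_le_sum fun τ hτ => ?_) (ih (fun ρ h => hR ρ (by simp [h]))
        hw'int hw'0 (N + 1) hf'an hf'w (fun q hq => ?_) T hT)
      · exact (analyticOrderAt_mul_of_ne_zero ((huan τ).fun_inv (hu0 τ (hT hτ)))
          (inv_ne_zero (hu0 τ (hT hτ))) (hhan τ (hT hτ)).deriv).ge
      · have := hsign q hq
        rw [List.map_cons, List.prod_cons] at this
        simpa only [hw', mul_assoc] using this) S hS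
    refine le_trans (Finset.sum_le_sum fun τ hτ => ?_) key
    exact (analyticOrderAt_mul_of_ne_zero (hpan τ)
      (pow_pos (one_add_mul_pos (hS hτ) hρ) _).ne' (hf τ (hS hτ))).ge

end Descartes

/-! ### The univariate function -/

section Univariate

open MeasureTheory Set

variable {m : ℕ}

/-- The function `q ↦ ∑ b_j`, summed over all `j` with `q < q_j`. It takes the partial sums of `b`
as values when the components of the vector `q` are decreasing. -/
noncomputable def tailSum (b q : Fin m → ℝ) (y : ℝ) : ℝ :=
  ∑ j, (Iio (q j)).indicator (fun _ => b j) y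

theorem integrableOn_tailSum (b q : Fin m → ℝ) : IntegrableOn (tailSum b q) (Icc (-1) 1) :=
  integrable_finsetSum _ fun _ _ => (integrable_const _).indicator measurableSet_Iio

theorem integral_indicator_mul_inv_one_add_mul_sq {τ : ℝ} (hτ : τ ∈ Ioo (-1 : ℝ) 1) {p : ℝ}
    (hp : p ∈ Icc (-1 : ℝ) 1) (β : ℝ) :
    ∫ q in Icc (-1 : ℝ) 1, (Iio p).indicator (fun _ => β) q * ((1 + τ * q) ^ 2)⁻¹ =
      β * (p / (1 + τ * p)) + β * (1 / (1 - τ)) := by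
  have hfun : (fun q => (Iio p).indicator (fun _ => β) q * ((1 + τ * q) ^ 2)⁻¹) =
      (Iio p).indicator fun q => β * ((1 + τ * q) ^ 2)⁻¹ := by
    funext q
    by_cases h : q ∈ Iio p <;> simp [h]
  have hset : Icc (-1 : ℝ) 1 ∩ Iio p = Ico (-1) p := by
    ext q
    simp only [mem_inter_iff, mem_Icc, mem_Iio, mem_Ico]
    exact ⟨fun h => ⟨h.1.1, h.2⟩, fun h => ⟨⟨h.1, h.2.le.trans hp.2⟩, h.2⟩⟩
  rw [hfun, setIntegral_indicator measurableSet_Iio, hset, integral_const_mul,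
    integral_Ico_eq_integral_Ioo, ← integral_Ioc_eq_integral_Ioo,
    ← intervalIntegral.integral_of_le hp.1]
  have hpos : ∀ q ∈ uIcc (-1) p, 0 < 1 + τ * q := fun q hq => by
    rw [uIcc_of_le hp.1] at hq
    exact one_add_mul_pos hτ ⟨hq.1, hq.2.trans hp.2⟩
  have hderiv : ∀ q ∈ uIcc (-1) p,
      HasDerivAt (fun q => q / (1 + τ * q)) ((1 + τ * q) ^ 2)⁻¹ q := by
    intro q hq
    have h1 : HasDerivAt (fun q : ℝ => 1 + τ * q) τ q := by
      simpa using ((hasDerivAt_id q).const_mul τ).const_add 1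
    refine ((hasDerivAt_id q).fun_div h1 (hpos q hq).ne').congr_deriv ?_
    simp only [id]
    ring
  have hcont : ContinuousOn (fun q : ℝ => ((1 + τ * q) ^ 2)⁻¹) (uIcc (-1) p) :=
    ContinuousOn.inv₀ (by fun_prop) fun q hq => (pow_pos (hpos q hq) 2).ne'
  rw [intervalIntegral.integral_eq_sub_of_hasDerivAt hderiv hcont.intervalIntegrable]
  ring

theorem analyticAt_sum_log {b c q : Fin m → ℝ} (hc : ∀ j, 0 < c j)
    (hq : ∀ j, q j ∈ Icc (-1 : ℝ) 1) {τ : ℝ} (hτ : τ ∈ Ioo (-1 : ℝ) 1) :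
    AnalyticAt ℝ (fun τ => ∑ j, b j * Real.log (c j * (1 + τ * q j))) τ :=
  Finset.analyticAt_fun_sum _ fun j _ => analyticAt_const.fun_mul <|
    (analyticAt_const.fun_mul (analyticAt_const.fun_add
      (analyticAt_id.fun_mul analyticAt_const))).real_log
        (mul_pos (hc j) (one_add_mul_pos hτ (hq j)))

/-- The derivative of `∑ b_j log (c_j (1 + τ q_j))` is the integral of the partial sums of `b`
against the kernel `(1 + τ q)⁻¹ ^ 2`. -/
theorem hasDerivAt_sum_log {b c q : Fin m → ℝ} (hb : ∑ j, b j = 0) (hc : ∀ j, 0 < c j)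
    (hq : ∀ j, q j ∈ Icc (-1 : ℝ) 1) {τ : ℝ} (hτ : τ ∈ Ioo (-1 : ℝ) 1) :
    HasDerivAt (fun τ => ∑ j, b j * Real.log (c j * (1 + τ * q j)))
      (∫ y in Icc (-1 : ℝ) 1, tailSum b q y * ((1 + τ * y) ^ (1 + 1))⁻¹) τ := by
  have h1 : ∀ j, HasDerivAt (fun τ => b j * Real.log (c j * (1 + τ * q j)))
      (b j * (q j / (1 + τ * q j))) τ := by
    intro j
    have hpos := one_add_mul_pos hτ (hq j)
    have h2 : HasDerivAt (fun t : ℝ => c j * (1 + t * q j)) (c j * q j) τ := by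
      simpa using (((hasDerivAt_id τ).mul_const (q j)).const_add 1).const_mul (c j)
    refine ((h2.log (mul_pos (hc j) hpos).ne').const_mul (b j)).congr_deriv ?_
    rw [mul_div_mul_left _ _ (hc j).ne']
  refine (HasDerivAt.fun_sum fun j _ => h1 j).congr_deriv ?_
  have h3 : ∀ j, IntegrableOn
      (fun y => (Iio (q j)).indicator (fun _ => b j) y * ((1 + τ * y) ^ (1 + 1))⁻¹)
      (Icc (-1 : ℝ) 1) := fun j =>
    integrableOn_mul_inv_one_add_mul_pow
      ((integrable_const (b j)).indicator measurableSet_Iio) hτ _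
  simp only [tailSum, Finset.sum_mul]
  rw [integral_finsetSum _ fun j _ => h3 j,
    Finset.sum_congr rfl fun j _ => integral_indicator_mul_inv_one_add_mul_sq hτ (hq j) (b j),
    Finset.sum_add_distrib, ← Finset.sum_mul, hb]
  ring

variable {k : ℕ}

theorem partialSums_mergeClasses (r : Fin m → Fin k) (b : Fin m → ℝ) (i : Fin (k - 1)) :
    partialSums (mergeClasses r b) i = ∑ j : Fin m with (r j).val ≤ i.val, b j := by
  simp only [partialSums, mergeClasses]
  have h := Finset.sum_fiberwise_of_maps_to (s := Finset.univ.filter fun j => (r j).val ≤ i.val)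
    (t := Finset.univ.filter fun t : Fin k => t.val ≤ i.val) (g := r) (f := b) (by simp)
  rw [← h]
  refine Finset.sum_congr rfl fun t ht => Finset.sum_congr ?_ fun _ _ => rfl
  ext j
  simp only [Finset.mem_filter, Finset.mem_univ, true_and] at ht ⊢
  exact ⟨fun h => ⟨h ▸ ht, h⟩, fun h => h.2⟩

/-- For a decreasing vector `q` with `k` classes of equal components, `Q` lists the distinct
components, extended constantly to all indices from `k - 1` on. On `[Q (i+1), Q i)` the function
`tailSum b q` is the `i`-th partial sum of the merged vector. -/
theorem exists_breakpoints {q : Fin m → ℝ} (hq : Antitone q) {r : Fin m → Fin k}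
    (hr : Monotone r) (hsurj : Function.Surjective r) (hrq : ∀ i j, r i = r j ↔ q i = q j)
    (hk : 0 < k) :
    ∃ Q : ℕ → ℝ, Antitone Q ∧ (∀ j, q j = Q (r j)) ∧ (∀ i, ∃ j, Q i = q j) ∧
      (∀ i, i < k - 1 → Q (i + 1) < Q i) ∧
      ∀ (b : Fin m → ℝ) (i : Fin (k - 1)) (y : ℝ), Q (i + 1) ≤ y → y < Q i →
        tailSum b q y = partialSums (mergeClasses r b) i := by
  choose s hs using hsurj
  have hcl : ∀ i : ℕ, min i (k - 1) < k := fun i => by omega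
  set Q : ℕ → ℝ := fun i => q (s ⟨min i (k - 1), hcl i⟩) with hQdef
  have hQ : Antitone Q := by
    intro i i' hii
    have hle : (⟨min i (k - 1), hcl i⟩ : Fin k) ≤ ⟨min i' (k - 1), hcl i'⟩ :=
      Fin.mk_le_mk.2 (min_le_min_right _ hii)
    rcases le_total (s ⟨min i (k - 1), hcl i⟩) (s ⟨min i' (k - 1), hcl i'⟩) with h | h
    · exact hq h
    · have h1 := hr h
      rw [hs, hs] at h1
      exact (congrArg (fun t => q (s t)) (le_antisymm hle h1)).ge
  have hqQ : ∀ j, q j = Q (r j) := fun j => by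
    refine (hrq _ _).1 ?_
    rw [hs]
    exact Fin.ext (by have := (r j).2; simp only; omega)
  have hlt : ∀ i, i < k - 1 → Q (i + 1) < Q i := fun i hi => by
    refine lt_of_le_of_ne (hQ (Nat.le_succ i)) fun h => ?_
    have h1 := (hrq _ _).2 h
    rw [hs, hs, Fin.mk.injEq] at h1
    omega
  refine ⟨Q, hQ, hqQ, fun i => ⟨_, rfl⟩, hlt, fun b i y h1 h2 => ?_⟩
  rw [partialSums_mergeClasses, tailSum, Finset.sum_filter]
  refine Finset.sum_congr rfl fun j _ => ?_
  by_cases hj : (r j).val ≤ i.val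
  · have : y ∈ Iio (q j) := by rw [hqQ j]; exact h2.trans_le (hQ hj)
    rw [if_pos hj, indicator_of_mem this]
  · have : y ∉ Iio (q j) := by
      rw [hqQ j, mem_Iio, not_lt]
      exact (hQ (by omega)).trans h1
    rw [if_neg hj, indicator_of_notMem this]

/-- The value of `tailSum b q` anywhere in `[-1, 1)` is one of the merged partial sums. -/
theorem exists_breakpoint_interval {Q : ℕ → ℝ} (h0 : Q 0 = 1) (hlast : Q (k - 1) = -1) {y : ℝ}
    (hy : y ∈ Ico (-1 : ℝ) 1) : ∃ i, i < k - 1 ∧ Q (i + 1) ≤ y ∧ y < Q i := by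
  classical
  have hex : ∃ t, Q t ≤ y := ⟨k - 1, hlast ▸ hy.1⟩
  have h1 : Nat.find hex ≠ 0 := fun h => by
    have := Nat.find_spec hex
    rw [h, h0] at this
    exact (this.trans_lt hy.2).false
  obtain ⟨i, hi⟩ := Nat.exists_eq_succ_of_ne_zero h1
  refine ⟨i, ?_, ?_, ?_⟩
  · have : Nat.find hex ≤ k - 1 := Nat.find_min' hex (hlast ▸ hy.1)
    omega
  · have := Nat.find_spec hex
    rwa [hi] at this
  · exact not_le.1 (Nat.find_min hex (by omega))

/-- Either all merged partial sums vanish and `∑ b_j log (c_j (1 + τ q_j))` has derivative zero, or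
it has at most one zero more in `(-1, 1)` than the merged partial sums have sign changes. -/
theorem sum_analyticOrderAt_sum_log_le {b c q : Fin m → ℝ} (hb : ∑ j, b j = 0)
    (hc : ∀ j, 0 < c j) (hq : Antitone q) {j₀ j₁ : Fin m} (h₀ : q j₀ = 1) (h₁ : q j₁ = -1)
    (hj₀ : ∀ j, j₀ ≤ j) (hj₁ : ∀ j, j ≤ j₁)
    {r : Fin m → Fin k} (hr : Monotone r) (hsurj : Function.Surjective r)
    (hrq : ∀ i j, r i = r j ↔ q i = q j) :
    (∀ τ ∈ Ioo (-1 : ℝ) 1,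
      HasDerivAt (fun τ => ∑ j, b j * Real.log (c j * (1 + τ * q j))) 0 τ) ∨
    ∀ S : Finset ℝ, ↑S ⊆ Ioo (-1 : ℝ) 1 →
      ∑ τ ∈ S, analyticOrderAt (fun τ => ∑ j, b j * Real.log (c j * (1 + τ * q j))) τ ≤
        (signVar (partialSums (mergeClasses r b)) + 1 : ℕ) := by
  have hk : 0 < k := Fin.pos (r j₀)
  have hqI : ∀ j, q j ∈ Icc (-1 : ℝ) 1 := fun j => ⟨h₁ ▸ hq (hj₁ j), h₀ ▸ hq (hj₀ j)⟩
  obtain ⟨Q, hQ, hqQ, hQq, hlt, htail⟩ := exists_breakpoints hq hr hsurj hrq hk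
  have hQI : ∀ i, Q i ∈ Icc (-1 : ℝ) 1 := fun i => by
    obtain ⟨j, hj⟩ := hQq i
    exact hj ▸ hqI j
  have hQ0 : Q 0 = 1 := le_antisymm (hQI 0).2 (by
    rw [← h₀, hqQ j₀]; exact hQ (Nat.zero_le _))
  have hQl : Q (k - 1) = -1 := le_antisymm (by
    rw [← h₁, hqQ j₁]; exact hQ (by have := (r j₁).2; omega)) (hQI _).1
  set L := List.ofFn (partialSums (mergeClasses r b)) with hL
  have hLlen : L.length = k - 1 := by simp [hL]
  have hderiv := fun τ hτ => hasDerivAt_sum_log (b := b) (c := c) (q := q) (τ := τ) hb hc hqI hτ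
  have hone : tailSum b q 1 = 0 :=
    Finset.sum_eq_zero fun j _ => indicator_of_notMem (by simpa using (hqI j).2) _
  cases hfil : (L.map SignType.sign).filter (· ≠ 0) with
  | nil =>
    left
    have hzero : ∀ i, partialSums (mergeClasses r b) i = 0 := by
      intro i
      by_contra hne
      have : SignType.sign (partialSums (mergeClasses r b) i) ∈
          (L.map SignType.sign).filter (· ≠ 0) := by
        simp only [List.mem_filter, List.mem_map]
        exact ⟨⟨_, (List.mem_ofFn' _ _).2 ⟨i, rfl⟩, rfl⟩, by simpa using hne⟩
      rw [hfil] at this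
      simp at this
    intro τ hτ
    refine (hderiv τ hτ).congr_deriv ?_
    rw [← integral_zero ℝ ℝ]
    refine setIntegral_congr_fun measurableSet_Icc fun y hy => ?_
    rcases eq_or_lt_of_le hy.2 with rfl | hy1
    · simp [hone]
    · obtain ⟨i, hi, h1, h2⟩ := exists_breakpoint_interval hQ0 hQl ⟨hy.1, hy1⟩
      simp [htail b ⟨i, hi⟩ y h1 h2, hzero]
  | cons ε t =>
    right
    obtain ⟨R, hRlen, hR, hsign⟩ := exists_cut_points L Q hQ
    have hε : (ε : ℝ) ≠ 0 := by
      have : ε ∈ (L.map SignType.sign).filter (· ≠ 0) := by rw [hfil]; simp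
      have h0 : ε ≠ 0 := by simpa using (List.mem_filter.1 this).2
      revert h0
      cases ε <;> simp
    obtain ⟨i₀, hi₀⟩ : ∃ i, partialSums (mergeClasses r b) i ≠ 0 := by
      by_contra! hzero
      have : ε ∈ (L.map SignType.sign).filter (· ≠ 0) := by rw [hfil]; simp
      simp only [List.mem_filter, List.mem_map, hL, List.mem_ofFn] at this
      obtain ⟨⟨y, ⟨i, rfl⟩, rfl⟩, h0⟩ := this
      simp [hzero i] at h0
    have hw0 : ¬ tailSum b q =ᵐ[volume.restrict (Icc (-1 : ℝ) 1)] 0 := by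
      intro h
      have hsub : Ico (Q (i₀ + 1)) (Q i₀) ⊆ Icc (-1 : ℝ) 1 := fun y hy =>
        ⟨(hQI _).1.trans hy.1, hy.2.le.trans (hQI _).2⟩
      have h2 : ∀ᵐ y ∂(volume.restrict (Ico (Q (i₀ + 1)) (Q i₀))), False := by
        filter_upwards [ae_restrict_of_ae_restrict_of_subset hsub h,
          ae_restrict_mem measurableSet_Ico] with y hy hyI
        rw [htail b i₀ y hyI.1 hyI.2] at hy
        exact hi₀ hy
      rw [ae_iff] at h2
      simp [(hlt i₀ i₀.2).not_ge] at h2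
    have hsign' : ∀ y ∈ Icc (-1 : ℝ) 1,
        0 ≤ (ε : ℝ) * tailSum b q y * (R.map (y - ·)).prod := by
      intro y hy
      rcases eq_or_lt_of_le hy.2 with rfl | hy1
      · simp [hone]
      · obtain ⟨i, hi, h1, h2⟩ := exists_breakpoint_interval hQ0 hQl ⟨hy.1, hy1⟩
        have := hsign ε (by rw [hfil]; simp) i (by omega) y h1 h2
        rw [htail b ⟨i, hi⟩ y h1 h2]
        simpa [hL] using this
    have han : AnalyticOnNhd ℝ (fun τ => ∑ j, b j * Real.log (c j * (1 + τ * q j)))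
        (Ioo (-1) 1) := fun τ hτ => analyticAt_sum_log hc hqI hτ
    refine sum_analyticOrderAt_le_of_deriv han fun S hS => ?_
    rw [signVar, ← hL, ← hRlen]
    exact sum_analyticOrderAt_integral_le R
      (fun ρ hρ => by obtain ⟨i, -, -, rfl⟩ := hR ρ hρ; exact hQI i)
      (integrableOn_tailSum b q) hw0 1 (fun τ hτ => (han τ hτ).deriv)
      (fun τ hτ => (hderiv τ hτ).deriv) hε hsign' S hS

end Univariate

/-! ### Reordering the columns and the form of the kernel -/

section Kernel

variable {n : ℕ}

theorem genPolySystem_submatrix {p m : ℕ} (A : Matrix (Fin p) (Fin m) ℝ)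
    (B : Matrix (Fin n) (Fin m) ℝ) (σ : Equiv.Perm (Fin m)) :
    genPolySystem (A.submatrix id σ) (B.submatrix id σ) = genPolySystem A B := by
  funext x i
  exact Equiv.sum_comp σ fun j => A i j * genMonomial x fun l => B l j

theorem finrank_ker_withOnesRow_submatrix {m : ℕ} (B : Matrix (Fin n) (Fin m) ℝ)
    (σ : Equiv.Perm (Fin m)) :
    Module.finrank ℝ (LinearMap.ker (withOnesRow (B.submatrix id σ)).mulVecLin) =
      Module.finrank ℝ (LinearMap.ker (withOnesRow B).mulVecLin) := by
  have h1 := LinearMap.finrank_range_add_finrank_ker (withOnesRow B).mulVecLin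
  have h2 := LinearMap.finrank_range_add_finrank_ker (withOnesRow (B.submatrix id σ)).mulVecLin
  have h3 : withOnesRow (B.submatrix id σ) =
      (withOnesRow B).submatrix (Equiv.refl (Fin n ⊕ Unit)) σ := by
    ext i j
    cases i <;> rfl
  have h4 := Matrix.rank_submatrix (withOnesRow B) (Equiv.refl (Fin n ⊕ Unit)) σ
  rw [← h3] at h4
  simp only [Matrix.rank] at h4
  omega

theorem mem_ker_submatrix_iff {p m : ℕ} (A : Matrix (Fin p) (Fin m) ℝ) (σ : Equiv.Perm (Fin m))
    (z : Fin m → ℝ) :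
    z ∈ LinearMap.ker (A.submatrix id σ).mulVecLin ↔ z ∘ σ.symm ∈ LinearMap.ker A.mulVecLin := by
  have h : (A.submatrix id σ).mulVec z = A.mulVec (z ∘ σ.symm) := by
    funext i
    have := Equiv.sum_comp σ fun j => A i j * z (σ.symm j)
    simpa [Matrix.mulVec, dotProduct] using this
  simp [LinearMap.mem_ker, h]

/-- A two-dimensional kernel with a positive vector `c` has the form `c ∘ im (1 q)`: for a second
kernel vector `w` the quotients `w_j / c_j` are sorted and normalized to the range `[-1, 1]`. -/
theorem exists_isKernelForm {A : Matrix (Fin n) (Fin (n + 2)) ℝ} (hrank : A.rank = n)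
    (hpos : ∃ y ∈ LinearMap.ker A.mulVecLin, ∀ j, 0 < y j) :
    ∃ (σ : Equiv.Perm (Fin (n + 2))) (c q : Fin (n + 2) → ℝ),
      IsKernelForm (A.submatrix id σ) c q := by
  obtain ⟨y, hy, hypos⟩ := hpos
  have hfin : Module.finrank ℝ (LinearMap.ker A.mulVecLin) = 2 := by
    have h := LinearMap.finrank_range_add_finrank_ker A.mulVecLin
    rw [Module.finrank_pi, Fintype.card_fin] at h
    simp only [Matrix.rank] at hrank
    omega
  obtain ⟨w, hw, hwy⟩ : ∃ w ∈ LinearMap.ker A.mulVecLin, w ∉ Submodule.span ℝ {y} := by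
    by_contra! hcon
    have h1 := Submodule.finrank_mono (show LinearMap.ker A.mulVecLin ≤ _ from hcon)
    have h2 := finrank_span_le_card (R := ℝ) ({y} : Set (Fin (n + 2) → ℝ))
    simp at h2
    omega
  have hyne : y ≠ 0 := fun h => (hypos 0).ne' (congrFun h 0)
  have hind : LinearIndependent ℝ ![y, w] := by
    rw [LinearIndependent.pair_iff' hyne]
    exact fun a ha => hwy (ha ▸ Submodule.smul_mem _ a (Submodule.mem_span_singleton_self y))
  have hspan : Submodule.span ℝ {y, w} = LinearMap.ker A.mulVecLin := by
    refine Submodule.eq_of_le_of_finrank_eq (Submodule.span_le.2 ?_) ?_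
    · intro v hv
      rcases hv with rfl | rfl
      exacts [hy, hw]
    · rw [hfin]
      have := finrank_span_eq_card hind
      rwa [Matrix.range_cons_cons_empty, Fintype.card_fin] at this
  set p : Fin (n + 2) → ℝ := fun j => w j / y j with hp
  set σ := Tuple.sort fun j => -p j with hσ
  have hanti : Antitone (p ∘ σ) := fun i j hij => by
    have := Tuple.monotone_sort (fun j => -p j) hij
    simpa using this
  have hyw : ∀ j, w j = y j * p j := fun j => by
    simp only [hp]; rw [mul_div_cancel₀ _ (hypos j).ne']
  have hlt : p (σ (Fin.last _)) < p (σ 0) := by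
    refine lt_of_le_of_ne (hanti (Fin.zero_le _)) fun heq => hwy ?_
    refine Submodule.mem_span_singleton.2 ⟨p (σ 0), funext fun j => ?_⟩
    have h1 := hanti (Fin.zero_le (σ.symm j))
    have h2 := hanti (Fin.le_last (σ.symm j))
    simp only [Function.comp_apply, Equiv.apply_symm_apply] at h1 h2
    have h3 : p j = p (σ 0) := le_antisymm h1 (heq ▸ h2)
    rw [hyw j, h3, Pi.smul_apply, smul_eq_mul, mul_comm]
  set M := p (σ 0)
  set N := p (σ (Fin.last _))
  have hMN : M - N ≠ 0 := (sub_pos.2 hlt).ne'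
  refine ⟨σ, y ∘ σ, fun j => (2 * p (σ j) - M - N) / (M - N),
    ⟨fun j => hypos _, fun i j hij => ?_, ?_, ?_, fun z => ?_⟩⟩
  · have := hanti hij
    simp only [Function.comp_apply] at this
    have h2 : 0 ≤ M - N := (sub_pos.2 hlt).le
    gcongr
  · rw [div_eq_one_iff_eq hMN]; ring
  · rw [div_eq_iff hMN]; ring
  · rw [mem_ker_submatrix_iff, ← hspan, Submodule.mem_span_pair]
    constructor
    · rintro ⟨s, t, h⟩
      refine ⟨s + t * ((M + N) / 2), t * ((M - N) / 2), fun j => ?_⟩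
      have := congrFun h (σ j)
      simp only [Pi.add_apply, Pi.smul_apply, smul_eq_mul, Function.comp_apply,
        Equiv.symm_apply_apply] at this
      rw [← this, hyw, Function.comp_apply]
      field_simp
      ring
    · rintro ⟨α, β, h⟩
      refine ⟨α - β * ((M + N) / (M - N)), β * (2 / (M - N)), funext fun j => ?_⟩
      rw [Function.comp_apply, h (σ.symm j)]
      simp only [Pi.add_apply, Pi.smul_apply, smul_eq_mul, Function.comp_apply,
        Equiv.apply_symm_apply]
      rw [hyw]
      field_simp
      ring

end Kernel

/-! ### Solutions and zeros of the univariate function -/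

section Solutions

variable {n : ℕ} {A B : Matrix (Fin n) (Fin (n + 2)) ℝ} {c q b : Fin (n + 2) → ℝ}

theorem IsKernelForm.exists_param (hK : IsKernelForm A c q) {x : Fin n → ℝ}
    (hx : x ∈ positiveSolutions A B) :
    ∃ αβ : ℝ × ℝ, ∀ j, genMonomial x (fun l => B l j) = c j * (αβ.1 + αβ.2 * q j) := by
  obtain ⟨α, β, h⟩ := (hK.ker_eq _).1 (LinearMap.mem_ker.2 hx.2)
  exact ⟨(α, β), h⟩

theorem IsKernelForm.param_unique (hK : IsKernelForm A c q) {α β α' β' : ℝ}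
    (h : ∀ j, c j * (α + β * q j) = c j * (α' + β' * q j)) : α = α' ∧ β = β' := by
  have h0 := mul_left_cancel₀ (hK.pos 0).ne' (h 0)
  have h1 := mul_left_cancel₀ (hK.pos (Fin.last _)).ne' (h (Fin.last _))
  rw [hK.first] at h0
  rw [hK.last] at h1
  constructor <;> linarith

/-- Two positive points whose monomial vectors are proportional are equal. -/
theorem eq_of_genMonomial_proportional {C : Matrix (Fin (n + 2)) (Fin n ⊕ Unit) ℝ}
    (hC : withOnesRow B * C = 1) {x x' : Fin n → ℝ} (hx : ∀ i, 0 < x i) (hx' : ∀ i, 0 < x' i)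
    {s : ℝ} (h : ∀ j, genMonomial x (fun l => B l j) = s * genMonomial x' (fun l => B l j)) :
    x = x' := by
  have hs : 0 < s := pos_of_mul_pos_left (h 0 ▸ genMonomial_pos hx _) (genMonomial_pos hx' _).le
  funext l
  obtain ⟨hCB, hC1⟩ := withOnesRow_mul_eq_one_col hC l
  have hlog : ∀ j, ∑ i, B i j * (Real.log (x i) - Real.log (x' i)) = Real.log s := fun j => by
    have h1 := congrArg Real.log (h j)
    rw [Real.log_mul hs.ne' (genMonomial_pos hx' _).ne', log_genMonomial hx,
      log_genMonomial hx'] at h1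
    simp only [mul_sub, Finset.sum_sub_distrib]
    linarith
  have h2 : ∑ j, C j (Sum.inl l) * ∑ i, B i j * (Real.log (x i) - Real.log (x' i)) =
      Real.log (x l) - Real.log (x' l) := by
    simp only [Finset.mul_sum]
    rw [Finset.sum_comm]
    have : ∀ i, ∑ j, C j (Sum.inl l) * (B i j * (Real.log (x i) - Real.log (x' i))) =
        (if i = l then 1 else 0) * (Real.log (x i) - Real.log (x' i)) := fun i => by
      rw [← hCB i, Finset.sum_mul]
      exact Finset.sum_congr rfl fun j _ => by ring
    simp [this]
  simp only [hlog, ← Finset.sum_mul, hC1, zero_mul] at h2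
  exact Real.log_injOn_pos (hx l) (hx' l) (by linarith)

theorem IsKernelForm.eval_param_eq_zero (hK : IsKernelForm A c q)
    (hb : b ∈ LinearMap.ker (withOnesRow B).mulVecLin) {x : Fin n → ℝ} (hx : ∀ i, 0 < x i)
    {α β : ℝ} (h : ∀ j, genMonomial x (fun l => B l j) = c j * (α + β * q j)) :
    ∑ j, b j * Real.log (c j * (1 + β / α * q j)) = 0 := by
  obtain ⟨hbB, hb1⟩ := mem_ker_withOnesRow.1 hb
  obtain ⟨hα, hτ⟩ := hK.param_mem fun j => h j ▸ genMonomial_pos hx _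
  have h1 : ∀ j, Real.log (c j * (1 + β / α * q j)) =
      ∑ l, B l j * Real.log (x l) - Real.log α := fun j => by
    rw [← log_genMonomial hx, h j,
      ← Real.log_div (h j ▸ genMonomial_pos hx _).ne' hα.ne']
    congr 1
    field_simp
  simp only [h1, mul_sub, Finset.sum_sub_distrib, ← Finset.sum_mul, hb1, zero_mul, sub_zero,
    Finset.mul_sum]
  rw [Finset.sum_comm]
  refine Finset.sum_eq_zero fun l _ => ?_
  calc ∑ j, b j * (B l j * Real.log (x l)) = (∑ j, B l j * b j) * Real.log (x l) := by
        rw [Finset.sum_mul]; exact Finset.sum_congr rfl fun j _ => by ring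
    _ = 0 := by rw [hbB, zero_mul]

/-- Every zero of the univariate function in `(-1, 1)` comes from a solution. -/
theorem IsKernelForm.exists_solution (hK : IsKernelForm A c q)
    (hB : Module.finrank ℝ (LinearMap.ker (withOnesRow B).mulVecLin) = 1)
    (hb : Submodule.span ℝ {b} = LinearMap.ker (withOnesRow B).mulVecLin)
    {τ : ℝ} (hτ : τ ∈ Set.Ioo (-1 : ℝ) 1)
    (h0 : ∑ j, b j * Real.log (c j * (1 + τ * q j)) = 0) :
    ∃ x ∈ positiveSolutions A B, ∃ s : ℝ, s ≠ 0 ∧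
      ∀ j, genMonomial x (fun l => B l j) = c j * (s + s * τ * q j) := by
  obtain ⟨C, hC⟩ := exists_right_inverse_withOnesRow hB
  set y : Fin (n + 2) → ℝ := fun j => Real.log (c j * (1 + τ * q j)) with hy
  -- The columns of `1 - C * M` lie in the kernel of `M`, hence are multiples of `b`.
  set D : Matrix (Fin (n + 2)) (Fin (n + 2)) ℝ := C * withOnesRow B - 1 with hD
  have hMD : withOnesRow B * D = 0 := by
    rw [hD, Matrix.mul_sub, ← Matrix.mul_assoc, hC, Matrix.one_mul, Matrix.mul_one, sub_self]
  have hyC : Matrix.vecMul y (C * withOnesRow B) = y := by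
    funext j
    have hcol : (fun i => D i j) ∈
        LinearMap.ker (withOnesRow B).mulVecLin := by
      rw [LinearMap.mem_ker, Matrix.mulVecLin_apply]
      funext i
      exact congrFun (congrFun hMD i) j
    rw [← hb] at hcol
    obtain ⟨t, ht⟩ := Submodule.mem_span_singleton.1 hcol
    have h2 : ∑ i, y i * D i j = 0 := by
      have h3 : ∀ i, D i j = t * b i := fun i => (congrFun ht i).symm
      calc ∑ i, y i * D i j = t * ∑ i, b i * y i := by
            rw [Finset.mul_sum]
            exact Finset.sum_congr rfl fun i _ => by rw [h3]; ring
        _ = 0 := by rw [h0, mul_zero]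
    simp only [hD, Matrix.sub_apply, mul_sub, Finset.sum_sub_distrib, Matrix.one_apply, mul_ite,
      mul_one, mul_zero, Finset.sum_ite_eq', Finset.mem_univ, if_true] at h2
    exact sub_eq_zero.1 h2
  rw [← Matrix.vecMul_vecMul] at hyC
  set v := Matrix.vecMul y C with hv
  have hyj : ∀ j, ∑ l, B l j * v (Sum.inl l) + v (Sum.inr ()) = y j := fun j => by
    have := congrFun hyC j
    simpa [Matrix.vecMul, dotProduct, withOnesRow, mul_comm] using this
  set x : Fin n → ℝ := fun l => Real.exp (v (Sum.inl l)) with hx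
  have hxpos : ∀ i, 0 < x i := fun i => Real.exp_pos _
  have hmon : ∀ j, genMonomial x (fun l => B l j) = c j *
      (Real.exp (-v (Sum.inr ())) + Real.exp (-v (Sum.inr ())) * τ * q j) := fun j => by
    rw [← Real.exp_log (genMonomial_pos hxpos _), log_genMonomial hxpos]
    have h1 : ∑ l, B l j * Real.log (x l) = y j + -v (Sum.inr ()) := by
      rw [← hyj j]; simp [hx]
    rw [h1, Real.exp_add, hy, Real.exp_log (hK.coeff_pos hτ j)]
    ring
  refine ⟨x, ⟨hxpos, LinearMap.mem_ker.1 ((hK.ker_eq _).2 ⟨_, _, hmon⟩)⟩, _,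
    (Real.exp_pos _).ne', hmon⟩

theorem one_add_signVar_le {m : ℕ} (s : Fin m → ℝ) (hm : 0 < m) : 1 + signVar s ≤ m := by
  have h1 := (List.destutter_sublist (R := (· ≠ ·))
    (((List.ofFn s).map SignType.sign).filter (· ≠ 0))).length_le
  have h2 := List.length_filter_le (· ≠ (0 : SignType)) ((List.ofFn s).map SignType.sign)
  rw [List.length_map, List.length_ofFn] at h2
  unfold signVar
  omega

theorem IsKernelForm.numPositiveSolutions_le (hK : IsKernelForm A c q) (hrank : A.rank = n)
    (hB : Module.finrank ℝ (LinearMap.ker (withOnesRow B).mulVecLin) = 1)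
    (hb : Submodule.span ℝ {b} = LinearMap.ker (withOnesRow B).mulVecLin)
    (hfin : (positiveSolutions A B).Finite) {k : ℕ} {r : Fin (n + 2) → Fin k} (hr : Monotone r)
    (hsurj : Function.Surjective r) (hrq : ∀ i j, r i = r j ↔ q i = q j) :
    numPositiveSolutions A B ≤
      ((1 + signVar (partialSums (mergeClasses r b)) : ℕ) : ℕ∞) := by
  classical
  have hbk : b ∈ LinearMap.ker (withOnesRow B).mulVecLin :=
    hb ▸ Submodule.mem_span_singleton_self b
  obtain ⟨C, hC⟩ := exists_right_inverse_withOnesRow hB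
  have := hfin.fintype
  rw [numPositiveSolutions, tsum_fintype]
  choose p hp using fun x : positiveSolutions A B => hK.exists_param x.2
  set τ : positiveSolutions A B → ℝ := fun x => (p x).2 / (p x).1 with hτ
  have hτmem : ∀ x, 0 < (p x).1 ∧ τ x ∈ Set.Ioo (-1 : ℝ) 1 := fun x =>
    hK.param_mem fun j => hp x j ▸ genMonomial_pos x.2.1 _
  have hτinj : Function.Injective τ := by
    intro x x' h
    have h1 := (hτmem x).1.ne'
    have h2 := (hτmem x').1.ne'
    refine Subtype.ext (eq_of_genMonomial_proportional hC x.2.1 x'.2.1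
      (s := (p x).1 / (p x').1) fun j => ?_)
    simp only [hτ] at h
    have h3 : (p x).2 = (p x').2 / (p x').1 * (p x).1 := (div_eq_iff h1).1 h
    rw [hp x j, hp x' j, h3]
    field_simp
  rcases sum_analyticOrderAt_sum_log_le (mem_ker_withOnesRow.1 hbk).2 hK.pos hK.anti hK.first
    hK.last Fin.zero_le Fin.le_last hr hsurj hrq with hzero | hle
  · -- The univariate function is constant, so a single solution would give infinitely many.
    have hempty : IsEmpty (positiveSolutions A B) := by
      refine ⟨fun x₀ => ?_⟩
      have hg : ∀ t ∈ Set.Ioo (-1 : ℝ) 1, ∑ j, b j * Real.log (c j * (1 + t * q j)) = 0 := by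
        intro t ht
        have h1 := isOpen_Ioo.is_const_of_deriv_eq_zero isPreconnected_Ioo
          (fun s hs => (hzero s hs).differentiableAt.differentiableWithinAt)
          (fun s hs => (hzero s hs).deriv) ht (hτmem x₀).2
        exact h1.trans (hK.eval_param_eq_zero hbk x₀.2.1 (hp x₀))
      have hsol : ∀ t ∈ Set.Ioo (-1 : ℝ) 1, ∃ x, τ x = t := by
        intro t ht
        obtain ⟨x, hx, s, hs, hmon⟩ := hK.exists_solution hB hb ht (hg t ht)
        refine ⟨⟨x, hx⟩, ?_⟩
        obtain ⟨h1, h2⟩ := hK.param_unique fun j => (hp ⟨x, hx⟩ j).symm.trans (hmon j)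
        simp only [hτ, h1, h2]
        field_simp
      refine Set.Ioo_infinite (show (-1 : ℝ) < 1 by norm_num) ?_
      exact (Set.finite_range τ).subset fun t ht => hsol t ht
    simp
  · calc ∑ x : positiveSolutions A B, zeroMultiplicity (genPolySystem A B) (x : Fin n → ℝ)
        ≤ ∑ x : positiveSolutions A B,
            analyticOrderAt (fun τ => ∑ j, b j * Real.log (c j * (1 + τ * q j))) (τ x) :=
          Finset.sum_le_sum fun x _ => zeroMultiplicity_le hrank hB hK hbk x.2 (hp x)
      _ = ∑ t ∈ Finset.univ.image τ,
            analyticOrderAt (fun τ => ∑ j, b j * Real.log (c j * (1 + τ * q j))) t :=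
          (Finset.sum_image hτinj.injOn).symm
      _ ≤ ((signVar (partialSums (mergeClasses r b)) + 1 : ℕ) : ℕ∞) := by
          refine hle _ fun t ht => ?_
          obtain ⟨x, -, rfl⟩ := Finset.mem_image.1 (Finset.mem_coe.1 ht)
          exact (hτmem x).2
      _ = _ := by rw [add_comm]

end Solutions

theorem mainTheorem3 {n : ℕ} (A B : Matrix (Fin n) (Fin (n + 2)) ℝ)
    (hrank : A.rank = n)
    (hpos : ∃ y ∈ LinearMap.ker A.mulVecLin, ∀ j, 0 < y j)
    (hA : ¬ IsDirectProduct (LinearMap.ker A.mulVecLin))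
    (hB : Module.finrank ℝ (LinearMap.ker (withOnesRow B).mulVecLin) = 1) :
    (∃ (σ : Equiv.Perm (Fin (n + 2))) (c q : Fin (n + 2) → ℝ),
      IsKernelForm (A.submatrix id σ) c q) ∧
    ∀ (σ : Equiv.Perm (Fin (n + 2))) (c q b : Fin (n + 2) → ℝ),
      IsKernelForm (A.submatrix id σ) c q →
      Submodule.span ℝ {b} = LinearMap.ker (withOnesRow (B.submatrix id σ)).mulVecLin →
      (positiveSolutions A B).Finite →
      (Function.Injective q →
        numPositiveSolutions A B ≤ ((1 + signVar (partialSums b) : ℕ) : ℕ∞) ∧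
        1 + signVar (partialSums b) ≤ n + 1) ∧
      ∀ (k : ℕ) (r : Fin (n + 2) → Fin k), Monotone r → Function.Surjective r →
        (∀ i j, r i = r j ↔ q i = q j) →
        numPositiveSolutions A B ≤
          ((1 + signVar (partialSums (mergeClasses r b)) : ℕ) : ℕ∞) ∧
        1 + signVar (partialSums (mergeClasses r b)) ≤ k - 1 := by
  refine ⟨exists_isKernelForm hrank hpos, fun σ c q b hK hb hfin => ?_⟩
  have hB' := (finrank_ker_withOnesRow_submatrix B σ).trans hB
  have hrank' : (A.submatrix id σ).rank = n :=
    (Matrix.rank_submatrix A (Equiv.refl (Fin n)) σ).trans hrank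
  have hsol : positiveSolutions (A.submatrix id σ) (B.submatrix id σ) = positiveSolutions A B := by
    simp only [positiveSolutions, genPolySystem_submatrix]
  have hnum : numPositiveSolutions (A.submatrix id σ) (B.submatrix id σ) =
      numPositiveSolutions A B := by
    unfold numPositiveSolutions positiveSolutions
    rw [genPolySystem_submatrix]
  have main : ∀ (k : ℕ) (r : Fin (n + 2) → Fin k), Monotone r → Function.Surjective r →
      (∀ i j, r i = r j ↔ q i = q j) →
      numPositiveSolutions A B ≤
        ((1 + signVar (partialSums (mergeClasses r b)) : ℕ) : ℕ∞) ∧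
      1 + signVar (partialSums (mergeClasses r b)) ≤ k - 1 := by
    intro k r hr hsurj hrq
    refine ⟨hnum ▸ hK.numPositiveSolutions_le hrank' hB' hb (hsol.symm ▸ hfin) hr hsurj hrq,
      one_add_signVar_le _ ?_⟩
    have hne : r 0 ≠ r (Fin.last _) := fun h => by
      have := (hrq _ _).1 h
      rw [hK.first, hK.last] at this
      norm_num at this
    have h1 : (r 0).val ≠ (r (Fin.last _)).val := fun h => hne (Fin.ext h)
    have := (r 0).2
    have := (r (Fin.last _)).2
    omega
  refine ⟨fun hq => ?_, main⟩
  have hid : mergeClasses id b = b := by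
    funext i
    simp [mergeClasses, Finset.filter_eq']
  have h := main (n + 2) id monotone_id Function.surjective_id fun i j => hq.eq_iff.symm
  rwa [hid] at h
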